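/- Let $D=\{z\in\mathbb{R}^2:|z|<1\}$ be the unit disc. For a smooth positive function $p$ on $\overline D$ consider the metric $p\,(dx^2+dy^2)$ on $\overline D$; its area is $\int_D p\,dx\,dy$, its Gaussian curvature is $K=-\frac1{2p}\Delta\log p$, and its Laplace operator is $\frac1p\Delta$. A real number $\gamma$ is a Dirichlet (Neumann) eigenvalue if there is a function $u\not\equiv0$, of class $C^2$ on $\overline D$, with $\frac1p\Delta u+\gamma u=0$ in $D$ and $u=0$ (respectively $\partial u/\partial\nu=0$) on $\partial D$. When $p$ is radial, the $S^1$-invariant eigenvalues are those of the problem restricted to rotation invariant functions $u$, listed in increasing order and repeated according to their multiplicity in that restricted problem. The non-invariant spectrum is the set of the eigenvalues that have an eigenfunction which is not rotation invariant. For $\delta>0$ let $$p(r,\delta)=\frac{\alpha}{r^2+\delta},\qquad \alpha=\alpha(\delta)=\frac{1}{\log\left(\frac{1+\delta}{\delta}\right)},\qquad r=|z|.$$ (1) For every $\delta>0$ the metric $p(r,\delta)(dx^2+dy^2)$ is smooth and $S^1$-invariant, has positive Gaussian curvature on $\overline D$ and has total area $\pi$. (2) For every integer $m\ge1$ and every $\varepsilon>0$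 there is $\delta_0(\varepsilon)=\delta_0(m,\varepsilon)>0$ such that, for all $\delta$ in the open interval $(0,\delta_0(\varepsilon))$, both the Neumann and the Dirichlet problem have an infinite increasing sequence of $S^1$-invariant eigenvalues, the first $m$ of which are smaller than $\varepsilon$. Moreover, for fixed $m$, the $\delta_0(\varepsilon)$ can be chosen such that the non-invariant spectrum becomes arbitrarily large on these intervals as $\varepsilon\to0$: for every $C$ there is $\varepsilon_0>0$ such that, for $0<\varepsilon<\varepsilon_0$ and $0<\delta<\delta_0(\varepsilon)$, all elements of the Neumann and Dirichlet non-invariant spectra are larger than $C$. (3) For every $\delta>0$, all elements of the Neumann and Dirichlet non-invariant spectra are at least $1/\alpha(\delta)$, and $1/\alpha(\delta)\to\infty$ as $\delta\to0^+$. Furthermore, there is a constant $c>0$, independent of $\delta$, such that for every $\delta>0$ all elements of both non-invariant spectra are at least $c$. -/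

import Mathlib

open Set Filter Topology MeasureTheory
open scoped ContDiff

noncomputable section

namespace DiscSpectrum

/-- The plane is `ℂ`; a metric on the unit disc in isothermic form `p (dx² + dy²)` is given by its
density `p : ℂ → ℝ`. The Laplace–Beltrami operator of that metric is `p⁻¹ (∂ₓ² + ∂ᵧ²)`. -/
def laplaceBeltrami (p u : ℂ → ℝ) (z : ℂ) : ℝ :=
  (1 / p z) * Laplacian.laplacian u z

/-- Gaussian curvature of `p (dx² + dy²)`. -/
def gaussCurvature (p : ℂ → ℝ) (z : ℂ) : ℝ :=
  -(1 / (2 * p z)) * Laplacian.laplacian (fun w => Real.log (p w)) z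

/-- Area of the unit disc for the metric `p (dx² + dy²)`. -/
def area (p : ℂ → ℝ) : ℝ :=
  ∫ z in Metric.ball (0 : ℂ) 1, p z

/-- The function `u` on the plane is invariant under the rotations `z ↦ c z`, `|c| = 1`. -/
def IsRotationInvariant (u : ℂ → ℝ) : Prop :=
  ∀ (c : Circle) (z : ℂ), u (c * z) = u z

/-- The two boundary conditions for the eigenvalue problem. -/
inductive BoundaryCondition where
  | dirichlet
  | neumann

/-- `u = 0` on the unit circle, resp. vanishing normal derivative (the outer unit normal
at `z` is `z`, and the conormal of a conformal metric is a positive multiple of it). -/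
def BoundaryCondition.Holds : BoundaryCondition → (ℂ → ℝ) → Prop
  | .dirichlet, u => ∀ z ∈ Metric.sphere (0 : ℂ) 1, u z = 0
  | .neumann, u => ∀ z ∈ Metric.sphere (0 : ℂ) 1,
      fderivWithin ℝ u (Metric.closedBall (0 : ℂ) 1) z z = 0

/-- `u` is a classical solution of `Δ_p u + γ u = 0` in the unit disc with boundary condition `b`,
of class `C²` up to the boundary. Functions on the closed disc are represented by functions on
the plane that vanish off the closed disc. -/
structure IsEigenSolution (p : ℂ → ℝ) (b : BoundaryCondition) (γ : ℝ) (u : ℂ → ℝ) : Prop where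
  contDiffOn : ContDiffOn ℝ 2 u (Metric.closedBall (0 : ℂ) 1)
  equation : ∀ z ∈ Metric.ball (0 : ℂ) 1, laplaceBeltrami p u z + γ * u z = 0
  boundary : b.Holds u
  off_disc : ∀ z ∉ Metric.closedBall (0 : ℂ) 1, u z = 0

lemma uniqueDiffOn_disc : UniqueDiffOn ℝ (Metric.closedBall (0 : ℂ) 1) := by
  refine uniqueDiffOn_convex (convex_closedBall _ _) ?_
  rw [interior_closedBall _ one_ne_zero]
  exact ⟨0, by simp⟩

lemma IsEigenSolution.contDiffAt {p : ℂ → ℝ} {b : BoundaryCondition} {γ : ℝ} {u : ℂ → ℝ}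
    (h : IsEigenSolution p b γ u) {z : ℂ} (hz : z ∈ Metric.ball (0 : ℂ) 1) :
    ContDiffAt ℝ 2 u z :=
  h.contDiffOn.contDiffAt
    (mem_of_superset (Metric.isOpen_ball.mem_nhds hz) Metric.ball_subset_closedBall)

lemma IsEigenSolution.zero (p : ℂ → ℝ) (b : BoundaryCondition) (γ : ℝ) :
    IsEigenSolution p b γ 0 where
  contDiffOn := contDiffOn_const
  equation z _ := by
    have : Laplacian.laplacian (0 : ℂ → ℝ) z = 0 := by
      have h := InnerProductSpace.laplacian_smul (0 : ℝ) (f := (0 : ℂ → ℝ)) (x := z)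
        contDiffAt_const
      simpa using h
    simp [laplaceBeltrami, this]
  boundary := by
    cases b with
    | dirichlet => intro z _; rfl
    | neumann =>
      intro z _
      have : fderivWithin ℝ (0 : ℂ → ℝ) (Metric.closedBall (0 : ℂ) 1) z = 0 := by
        exact fderivWithin_const_apply (0 : ℝ)
      rw [this]; rfl
  off_disc _ _ := rfl

lemma IsEigenSolution.add {p : ℂ → ℝ} {b : BoundaryCondition} {γ : ℝ} {u v : ℂ → ℝ}
    (hu : IsEigenSolution p b γ u) (hv : IsEigenSolution p b γ v) :
    IsEigenSolution p b γ (u + v) where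
  contDiffOn := hu.contDiffOn.add hv.contDiffOn
  equation z hz := by
    have h1 := hu.equation z hz
    have h2 := hv.equation z hz
    have h3 := (hu.contDiffAt hz).laplacian_add (hv.contDiffAt hz)
    simp only [laplaceBeltrami, Pi.add_apply] at *
    rw [h3]
    linear_combination h1 + h2
  boundary := by
    have h1 := hu.boundary
    have h2 := hv.boundary
    cases b with
    | dirichlet =>
      intro z hz
      have e1 : u z = 0 := h1 z hz
      have e2 : v z = 0 := h2 z hz
      simp [e1, e2]
    | neumann =>
      intro z hz
      have e1 := h1 z hz
      have e2 := h2 z hz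
      have hz' := Metric.sphere_subset_closedBall hz
      rw [fderivWithin_add (uniqueDiffOn_disc z hz')
        (hu.contDiffOn.differentiableOn (by norm_num) z hz')
        (hv.contDiffOn.differentiableOn (by norm_num) z hz')]
      simp [e1, e2]
  off_disc z hz := by simp [hu.off_disc z hz, hv.off_disc z hz]

lemma IsEigenSolution.smul {p : ℂ → ℝ} {b : BoundaryCondition} {γ : ℝ} {u : ℂ → ℝ} (a : ℝ)
    (hu : IsEigenSolution p b γ u) : IsEigenSolution p b γ (a • u) where
  contDiffOn := hu.contDiffOn.const_smul a
  equation z hz := by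
    have h1 := hu.equation z hz
    have h3 := InnerProductSpace.laplacian_smul a (hu.contDiffAt hz)
    simp only [laplaceBeltrami, Pi.smul_apply, smul_eq_mul] at *
    rw [h3]
    linear_combination a * h1
  boundary := by
    have h1 := hu.boundary
    cases b with
    | dirichlet =>
      intro z hz
      have e1 : u z = 0 := h1 z hz
      simp [e1]
    | neumann =>
      intro z hz
      have e1 := h1 z hz
      have hz' := Metric.sphere_subset_closedBall hz
      rw [fderivWithin_const_smul (uniqueDiffOn_disc z hz')
        (hu.contDiffOn.differentiableOn (by norm_num) z hz')]
      simp [e1]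
  off_disc z hz := by simp [hu.off_disc z hz]

/-- The eigenspace of the Laplace operator of `p (dx² + dy²)` on rotation invariant functions. -/
def invariantEigenspace (p : ℂ → ℝ) (b : BoundaryCondition) (γ : ℝ) : Submodule ℝ (ℂ → ℝ) where
  carrier := {u | IsEigenSolution p b γ u ∧ IsRotationInvariant u}
  zero_mem' := ⟨IsEigenSolution.zero p b γ, fun _ _ => rfl⟩
  add_mem' hu hv := ⟨hu.1.add hv.1, fun c z => by simp [hu.2 c z, hv.2 c z]⟩
  smul_mem' a _ hu := ⟨hu.1.smul a, fun c z => by simp [hu.2 c z]⟩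

/-- `ev 0 ≤ ev 1 ≤ …` is the list of all the rotation invariant eigenvalues in increasing order,
each repeated according to its multiplicity. -/
def IsInvariantEigenvalueList (p : ℂ → ℝ) (b : BoundaryCondition) (ev : ℕ → ℝ) : Prop :=
  Monotone ev ∧
    ∀ γ : ℝ, Module.rank ℝ (invariantEigenspace p b γ) = Cardinal.mk {j : ℕ // ev j = γ}

/-- The eigenvalues that have an eigenfunction which is not rotation invariant. -/
def nonInvariantSpectrum (p : ℂ → ℝ) (b : BoundaryCondition) : Set ℝ :=
  {γ | ∃ u : ℂ → ℝ, IsEigenSolution p b γ u ∧ ¬ IsRotationInvariant u}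

/-- The normalizing constant `α = 1 / log ((1 + δ) / δ)`. -/
def alpha (δ : ℝ) : ℝ :=
  1 / Real.log ((1 + δ) / δ)

/-- The one-parameter family of densities `p(r, δ) = α / (r² + δ)`. -/
def density (δ : ℝ) (z : ℂ) : ℝ :=
  alpha δ / (‖z‖ ^ 2 + δ)

end DiscSpectrum

end

open DiscSpectrum

namespace DiscSpectrum

/-! ### The Laplacian in logarithmic polar coordinates -/

/-! With t = log r the equation Δu + γpu = 0 becomes u_tt + u_θθ + γα w u = 0 on t < 0, where w =
r²/(r²+δ) increases from 0 at the centre to 1/(1+δ) on the boundary.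

Non-invariant spectrum. A Fourier mode f of frequency k ≥ 1 solves f'' = (k² − γα w) f. If γα < 1 +
δ the bracket is positive, so (f f')' ≥ 0. But f f' tends to 0 at −∞ by regularity at the centre and
at 0 by either boundary condition, so f = 0 (`IsEigenSolution.integral_mul_eq_zero`). Hence an
eigenvalue with a non-invariant eigenfunction is at least (1+δ)/α, which yields both the bound 1/α
and, by log x ≥ 1 − 1/x, the constant c = 1.

Invariant spectrum. In the variable w, with l = γα/4, the radial equation is (1−w)(w(1−w)G')' + lG =
0. It contains no δ, which enters only through l and the endpoint w = 1/(1+δ). The regular solution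
G is a power series on |w| < 1; let P = −w(1−w)G', that is w times `radialFlux`. The curve G + iP
avoids 0 on [0, 1), and its continuous argument φ, with φ = 0 at w = 0, is a Prüfer angle: the
Dirichlet condition reads cos φ = 0, the Neumann condition sin φ = 0. At the endpoint φ stays above
−π/2, is strictly increasing in l by a Wronskian identity (`strictMono_phase`) and is unbounded. So
the invariant eigenvalues are simple, and the j-th is the place where φ equals π/2 + jπ,
respectively jπ, counting from j = 0.

Small eigenvalues. Replacing G + iP by κG + iP changes the argument by at most a quarter turn, and
if κ² ≤ l the angular velocity is at least κ/(1−w). This gives `sqrt_mul_log_le_phase`. At γ = ε the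
resulting bound on φ is of order √(ε/(8α)), which exceeds mπ once δ is small, so the first m
eigenvalues are below ε. Taking also δ₀(ε) ≤ ε forces 1/α, and with it the non-invariant spectrum,
to infinity. -/

lemma fderiv_fderiv_add_rotate (u : ℂ → ℝ) (z a : ℂ) :
    fderiv ℝ (fderiv ℝ u) z a a + fderiv ℝ (fderiv ℝ u) z (Complex.I * a) (Complex.I * a) =
      ‖a‖ ^ 2 * Laplacian.laplacian u z := by
  have ha : a = a.re • (1 : ℂ) + a.im • Complex.I := by
    simp [Complex.re_add_im]
  have hia : Complex.I * a = (-a.im) • (1 : ℂ) + a.re • Complex.I := by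
    apply Complex.ext <;> simp
  rw [InnerProductSpace.laplacian_eq_iteratedFDeriv_complexPlane]
  simp only [iteratedFDeriv_two_apply, Fin.isValue, Matrix.cons_val_zero, Matrix.cons_val_one]
  rw [hia, ← Complex.normSq_eq_norm_sq, Complex.normSq_apply]
  conv_lhs => rw [ha]
  simp only [map_add, map_smul, add_apply, smul_apply,
    smul_eq_mul]
  simp
  ring

/-- Rays in logarithmic radius (v = 1) and circles in the angle (v = I) both satisfy c' = v c, so
one chain rule serves both polar directions. -/
lemma hasDerivAt_comp_spiral {u : ℂ → ℝ} {c : ℝ → ℂ} {v : ℂ} {t : ℝ}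
    (hu : DifferentiableAt ℝ u (c t)) (hc : HasDerivAt c (v * c t) t) :
    HasDerivAt (fun x => u (c x)) (fderiv ℝ u (c t) (v * c t)) t :=
  hu.hasFDerivAt.comp_hasDerivAt t hc

lemma hasDerivAt_fderiv_spiral {u : ℂ → ℝ} {c : ℝ → ℂ} {v : ℂ} {t : ℝ}
    (hu : ContDiffAt ℝ 2 u (c t)) (hc : HasDerivAt c (v * c t) t) :
    HasDerivAt (fun x => fderiv ℝ u (c x) (v * c x))
      (fderiv ℝ (fderiv ℝ u) (c t) (v * c t) (v * c t) + fderiv ℝ u (c t) (v * (v * c t))) t := by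
  have h1 : DifferentiableAt ℝ (fderiv ℝ u) (c t) :=
    (hu.fderiv_right (m := 1) (by norm_num)).differentiableAt (by norm_num)
  have h2 := h1.hasFDerivAt.comp_hasDerivAt t hc
  exact h2.clm_apply (hc.const_mul v)

lemma hasDerivAt_cexp_line (w v : ℂ) (x : ℝ) :
    HasDerivAt (fun x : ℝ => Complex.exp (w + v * x)) (v * Complex.exp (w + v * x)) x := by
  have h : HasDerivAt (fun x : ℝ => w + v * (x : ℂ)) v x := by
    simpa using ((Complex.ofRealCLM.hasDerivAt (x := x)).const_mul v).const_add w
  simpa [mul_comm] using h.cexp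

lemma eventually_contDiffAt_two {u : ℂ → ℝ} {z : ℂ} (hu : ContDiffAt ℝ 2 u z) :
    ∀ᶠ y in 𝓝 z, ContDiffAt ℝ 2 u y :=
  hu.eventually (by norm_num)

lemma deriv_deriv_comp_cexp_line {u : ℂ → ℝ} {w : ℂ} (v : ℂ) (x : ℝ)
    (hu : ContDiffAt ℝ 2 u (Complex.exp (w + v * x))) :
    deriv (deriv (fun x : ℝ => u (Complex.exp (w + v * x)))) x =
      fderiv ℝ (fderiv ℝ u) (Complex.exp (w + v * x)) (v * Complex.exp (w + v * x))
          (v * Complex.exp (w + v * x)) +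
        fderiv ℝ u (Complex.exp (w + v * x)) (v * (v * Complex.exp (w + v * x))) := by
  have hc : ContinuousAt (fun x : ℝ => Complex.exp (w + v * x)) x := by fun_prop
  have he : deriv (fun x : ℝ => u (Complex.exp (w + v * x))) =ᶠ[𝓝 x]
      fun x => fderiv ℝ u (Complex.exp (w + v * x)) (v * Complex.exp (w + v * x)) := by
    filter_upwards [hc.eventually (eventually_contDiffAt_two hu)] with y hy
    exact (hasDerivAt_comp_spiral (c := fun x : ℝ => Complex.exp (w + v * x))
      (hy.differentiableAt (by norm_num)) (hasDerivAt_cexp_line w v y)).deriv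
  rw [he.deriv_eq]
  exact (hasDerivAt_fderiv_spiral (c := fun x : ℝ => Complex.exp (w + v * x)) hu
    (hasDerivAt_cexp_line w v x)).deriv

lemma IsRotationInvariant.apply_eq {u : ℂ → ℝ} (hu : IsRotationInvariant u) {z y : ℂ}
    (h : ‖z‖ = ‖y‖) : u z = u y := by
  rcases eq_or_ne y 0 with rfl | hy
  · rw [norm_zero, norm_eq_zero] at h
    rw [h]
  · have hc : z / y ∈ Submonoid.unitSphere ℂ := by
      rw [Submonoid.unitSphere, ← SetLike.mem_coe]
      simp only [Submonoid.coe_set_mk, Subsemigroup.coe_set_mk, mem_sphere_zero_iff_norm]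
      rw [norm_div, h, div_self (norm_ne_zero_iff.2 hy)]
    have := hu ⟨z / y, hc⟩ y
    rwa [show ((⟨z / y, hc⟩ : Circle) : ℂ) * y = z from div_mul_cancel₀ z hy] at this

/-- The Laplacian of a rotation invariant function in the coordinate `t = log ‖z‖`. -/
lemma IsRotationInvariant.norm_sq_mul_laplacian {u : ℂ → ℝ} (hinv : IsRotationInvariant u) {z : ℂ}
    (hz : z ≠ 0) (hu : ContDiffAt ℝ 2 u z) :
    ‖z‖ ^ 2 * Laplacian.laplacian u z =
      deriv (deriv (fun t : ℝ => u (Real.exp t))) (Real.log ‖z‖) := by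
  set τ := Real.log ‖z‖
  have hr : Real.exp τ = ‖z‖ := Real.exp_log (norm_pos_iff.2 hz)
  set w : ℂ := Complex.arg z * Complex.I with hw
  have hzw : Complex.exp (w + 1 * (τ : ℝ)) = z := by
    rw [one_mul, add_comm, Complex.exp_add, ← Complex.ofReal_exp, hr]
    exact Complex.norm_mul_exp_arg_mul_I z
  have hzw' : Complex.exp ((w + 1 * (τ : ℝ)) + Complex.I * (0 : ℝ)) = z := by simpa using hzw
  have h1 := deriv_deriv_comp_cexp_line (u := u) (w := w) 1 τ (by rwa [hzw])
  have h2 := deriv_deriv_comp_cexp_line (u := u) (w := w + 1 * (τ : ℝ)) Complex.I 0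
    (by rwa [hzw'])
  have e1 : (fun x : ℝ => u (Complex.exp (w + 1 * x))) = fun t : ℝ => u (Real.exp t) := by
    funext t
    apply hinv.apply_eq
    rw [Complex.norm_exp, hw]
    simp [Complex.norm_exp]
  have e2 : (fun x : ℝ => u (Complex.exp ((w + 1 * (τ : ℝ)) + Complex.I * x))) =
      fun _ => u z := by
    funext t
    apply hinv.apply_eq
    rw [← hzw, Complex.norm_exp, Complex.norm_exp]
    simp
  rw [e1, hzw] at h1
  rw [e2, hzw'] at h2
  rw [h1, ← fderiv_fderiv_add_rotate]
  -- The first-order terms of the two second derivatives are Du(z) and Du(−z), so they cancel in the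
  -- sum; the angular second derivative is 0 by invariance.
  have h3 : Complex.I * (Complex.I * z) = -z := by
    rw [← mul_assoc, Complex.I_mul_I, neg_one_mul]
  simp only [deriv_const', h3, map_neg, one_mul] at h2 ⊢
  linarith

lemma continuousAt_laplacian {u : ℂ → ℝ} {z : ℂ} (hu : ContDiffAt ℝ 2 u z) :
    ContinuousAt (Laplacian.laplacian u) z := by
  rw [InnerProductSpace.laplacian_eq_iteratedFDeriv_complexPlane]
  have h : ContinuousAt (iteratedFDeriv ℝ 2 u) z := by
    exact (hu.iteratedFDeriv_right (m := 0) (i := 2) (by norm_num)).continuousAt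
  exact (h.eval_const _).add (h.eval_const _)

/-- An identity for the Laplacian that holds off the origin holds at the origin. -/
lemma laplacian_eq_of_forall_ne_zero {u g : ℂ → ℝ} {s : Set ℂ} (hs : IsOpen s)
    (hu : ∀ z ∈ s, ContDiffAt ℝ 2 u z) (hg : ∀ z ∈ s, ContinuousAt g z)
    (h : ∀ z ∈ s, z ≠ 0 → Laplacian.laplacian u z = g z) :
    ∀ z ∈ s, Laplacian.laplacian u z = g z := by
  intro z hz
  by_cases h0 : z = 0
  · have h1 : Tendsto (Laplacian.laplacian u) (𝓝[≠] z) (𝓝 (Laplacian.laplacian u z)) :=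
      (continuousAt_laplacian (hu z hz)).tendsto.mono_left nhdsWithin_le_nhds
    have h2 : Tendsto g (𝓝[≠] z) (𝓝 (g z)) := (hg z hz).tendsto.mono_left nhdsWithin_le_nhds
    refine tendsto_nhds_unique (h1.congr' ?_) h2
    filter_upwards [self_mem_nhdsWithin, mem_nhdsWithin_of_mem_nhds (hs.mem_nhds hz)] with y hy hys
    exact h y hys (by rw [h0] at hy; exact hy)
  · exact h z hz h0

/-! ### The metric -/

lemma log_one_add_div_pos {δ : ℝ} (hδ : 0 < δ) : 0 < Real.log ((1 + δ) / δ) :=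
  Real.log_pos (by rw [lt_div_iff₀ hδ]; linarith)

lemma alpha_pos {δ : ℝ} (hδ : 0 < δ) : 0 < alpha δ :=
  one_div_pos.2 (log_one_add_div_pos hδ)

lemma one_div_alpha (δ : ℝ) : 1 / alpha δ = Real.log ((1 + δ) / δ) := by
  simp [alpha]

lemma norm_sq_add_pos {δ : ℝ} (hδ : 0 < δ) (z : ℂ) : 0 < ‖z‖ ^ 2 + δ := by positivity

lemma contDiff_norm_sq_complex {n : WithTop ℕ∞} : ContDiff ℝ n (fun z : ℂ => ‖z‖ ^ 2) :=
  contDiff_norm_sq ℝ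

lemma density_pos {δ : ℝ} (hδ : 0 < δ) (z : ℂ) : 0 < density δ z :=
  div_pos (alpha_pos hδ) (norm_sq_add_pos hδ z)

lemma contDiff_density {δ : ℝ} (hδ : 0 < δ) : ContDiff ℝ ∞ (density δ) :=
  contDiff_const.div (contDiff_norm_sq_complex.add contDiff_const)
    fun z => (norm_sq_add_pos hδ z).ne'

lemma density_eq_of_norm_eq {δ : ℝ} {z y : ℂ} (h : ‖z‖ = ‖y‖) : density δ z = density δ y := by
  simp [density, h]

lemma isRotationInvariant_density (δ : ℝ) : IsRotationInvariant (density δ) :=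
  fun c z => density_eq_of_norm_eq (by rw [norm_mul, Circle.norm_coe, one_mul])

lemma hasDerivAt_exp_sq_add (δ t : ℝ) :
    HasDerivAt (fun t : ℝ => Real.exp t ^ 2 + δ) (2 * Real.exp t ^ 2) t := by
  convert! ((Real.hasDerivAt_exp t).pow 2).add_const δ using 1
  ring

/-- In t = log r the function log p is a constant minus log(e^{2t} + δ), which is differentiated
twice; continuity supplies the origin. The curvature is therefore 2δ/(α(r²+δ)). -/
lemma laplacian_log_density {δ : ℝ} (hδ : 0 < δ) (z : ℂ) :
    Laplacian.laplacian (fun w => Real.log (density δ w)) z = -(4 * δ / (‖z‖ ^ 2 + δ) ^ 2) := by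
  have hC : ContDiff ℝ 2 (fun w => Real.log (density δ w)) :=
    ((contDiff_density hδ).of_le (by norm_cast)).log fun z => (density_pos hδ z).ne'
  have hinv : IsRotationInvariant (fun w => Real.log (density δ w)) := fun c z => by
    simp only [isRotationInvariant_density δ c z]
  refine laplacian_eq_of_forall_ne_zero (g := fun z => -(4 * δ / (‖z‖ ^ 2 + δ) ^ 2)) isOpen_univ
    (fun z _ => hC.contDiffAt) (fun z _ => ?_) (fun z _ hz => ?_) z (mem_univ z)
  · have := (norm_sq_add_pos hδ z).ne'
    have h2 : (‖z‖ ^ 2 + δ) ^ 2 ≠ 0 := pow_ne_zero 2 this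
    fun_prop (disch := assumption)
  · have h := hinv.norm_sq_mul_laplacian hz hC.contDiffAt
    have hp : ∀ t : ℝ, 0 < Real.exp t ^ 2 + δ := fun t => by positivity
    have e1 : (fun t : ℝ => Real.log (density δ (Real.exp t : ℝ))) =
        fun t => Real.log (alpha δ) - Real.log (Real.exp t ^ 2 + δ) := by
      funext t
      rw [density, Real.log_div (alpha_pos hδ).ne' (norm_sq_add_pos hδ _).ne', Complex.norm_real,
        Real.norm_eq_abs, sq_abs]
    have e2 : deriv (fun t : ℝ => Real.log (alpha δ) - Real.log (Real.exp t ^ 2 + δ)) =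
        fun t => -(2 * Real.exp t ^ 2 / (Real.exp t ^ 2 + δ)) := by
      funext t
      exact (((hasDerivAt_exp_sq_add δ t).log (hp t).ne').const_sub _).deriv
    have e3 : ∀ t, deriv (fun t => -(2 * Real.exp t ^ 2 / (Real.exp t ^ 2 + δ))) t =
        -(4 * δ * Real.exp t ^ 2 / (Real.exp t ^ 2 + δ) ^ 2) := by
      intro t
      have h1 : HasDerivAt (fun t : ℝ => 2 * Real.exp t ^ 2) (2 * (2 * Real.exp t ^ 2)) t := by
        simpa using (hasDerivAt_exp_sq_add 0 t).const_mul 2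
      refine ((h1.div (hasDerivAt_exp_sq_add δ t) (hp t).ne').neg).deriv.trans ?_
      ring
    rw [e1, e2, e3, Real.exp_log (norm_pos_iff.2 hz)] at h
    have hz2 : ‖z‖ ^ 2 ≠ 0 := pow_ne_zero 2 (norm_ne_zero_iff.2 hz)
    apply mul_left_cancel₀ hz2
    rw [h]
    ring

lemma gaussCurvature_density_pos {δ : ℝ} (hδ : 0 < δ) (z : ℂ) :
    0 < gaussCurvature (density δ) z := by
  have h1 := density_pos hδ z
  have h2 := norm_sq_add_pos hδ z
  rw [gaussCurvature, laplacian_log_density hδ, neg_mul_neg]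
  positivity

/-- Polar coordinates give 2πα ∫ r/(r²+δ) dr = πα log((1+δ)/δ), and α is the reciprocal of this
logarithm. -/
lemma area_density {δ : ℝ} (hδ : 0 < δ) : area (density δ) = Real.pi := by
  have h1 : area (density δ) = ∫ z : ℂ, (Iio (1 : ℝ)).indicator
      (fun r => alpha δ / (r ^ 2 + δ)) ‖z‖ := by
    rw [area, ← integral_indicator Metric.isOpen_ball.measurableSet]
    congr 1
    funext z
    simp [indicator, density]
  rw [h1, integral_fun_norm_addHaar, Complex.finrank_real_complex]
  have h2 : ∫ y in Ioi (0 : ℝ), y ^ (2 - 1) • (Iio (1 : ℝ)).indicator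
      (fun r => alpha δ / (r ^ 2 + δ)) y = ∫ y in (0 : ℝ)..1, y * (alpha δ / (y ^ 2 + δ)) := by
    rw [intervalIntegral.integral_of_le zero_le_one, integral_Ioc_eq_integral_Ioo,
      ← Ioi_inter_Iio, ← setIntegral_indicator measurableSet_Iio]
    congr 1
    funext y
    by_cases hy : y ∈ Iio (1 : ℝ) <;> simp [hy]
  have h3 : ∫ y in (0 : ℝ)..1, y * (alpha δ / (y ^ 2 + δ)) =
      alpha δ / 2 * Real.log (1 ^ 2 + δ) - alpha δ / 2 * Real.log (0 ^ 2 + δ) := by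
    have hp : ∀ x : ℝ, x ^ 2 + δ ≠ 0 := fun x => by positivity
    apply intervalIntegral.integral_eq_sub_of_hasDerivAt
      (f := fun x => alpha δ / 2 * Real.log (x ^ 2 + δ))
    · intro x _
      have := (((hasDerivAt_pow 2 x).add_const δ).log (hp x)).const_mul (alpha δ / 2)
      convert! this using 1
      simp
      ring
    · apply Continuous.intervalIntegrable
      fun_prop (disch := exact hp _)
  rw [h2, h3, ← mul_sub, one_pow, zero_pow two_ne_zero, zero_add,
    ← Real.log_div (by positivity) hδ.ne']
  have h4 := (log_one_add_div_pos hδ).ne'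
  have h5 : (volume : Measure ℂ).real (Metric.ball 0 1) = Real.pi := by
    simp [Measure.real]
  rw [h5, alpha]
  simp
  field_simp

lemma tendsto_one_div_alpha : Tendsto (fun δ : ℝ => 1 / alpha δ) (𝓝[>] 0) atTop := by
  simp_rw [one_div_alpha]
  refine Real.tendsto_log_atTop.comp ?_
  refine (tendsto_atTop_add_const_left _ 1 tendsto_inv_nhdsGT_zero).congr' ?_
  filter_upwards [self_mem_nhdsWithin] with δ hδ
  have : δ ≠ 0 := (mem_Ioi.1 hδ).ne'
  field_simp
  ring

/-! ### Fourier modes of eigenfunctions -/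

/-- The dominating function is a constant: the bound of F' on a compact neighbourhood of x₀ times
the integration interval. -/
lemma hasDerivAt_intervalIntegral_of_continuousOn {F F' : ℝ → ℝ → ℝ} {s : Set ℝ} (hs : IsOpen s)
    {a b : ℝ} (hF : ContinuousOn (Function.uncurry F) (s ×ˢ univ))
    (hF' : ContinuousOn (Function.uncurry F') (s ×ˢ univ))
    (hd : ∀ x ∈ s, ∀ θ, HasDerivAt (fun x => F x θ) (F' x θ) x) {x₀ : ℝ} (hx₀ : x₀ ∈ s) :
    HasDerivAt (fun x => ∫ θ in a..b, F x θ) (∫ θ in a..b, F' x₀ θ) x₀ := by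
  have slice : ∀ {H : ℝ → ℝ → ℝ}, ContinuousOn (Function.uncurry H) (s ×ˢ univ) →
      ∀ x ∈ s, Continuous (H x) := by
    intro H hH x hx
    rw [← continuousOn_univ]
    exact hH.comp (f := fun θ => (x, θ)) (by fun_prop) (fun θ _ => ⟨hx, mem_univ _⟩)
  obtain ⟨ε, hε, hball⟩ := Metric.nhds_basis_closedBall.mem_iff.1 (hs.mem_nhds hx₀)
  have hK : IsCompact (Metric.closedBall x₀ ε ×ˢ uIcc a b) :=
    (isCompact_closedBall _ _).prod isCompact_uIcc
  obtain ⟨M, hM⟩ := hK.exists_bound_of_continuousOn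
    (hF'.mono (prod_mono hball (subset_univ _)))
  refine (intervalIntegral.hasDerivAt_integral_of_dominated_loc_of_deriv_le (bound := fun _ => M)
    (s := Metric.closedBall x₀ ε) (Metric.closedBall_mem_nhds _ hε) ?_ ?_ ?_ ?_ ?_ ?_).2
  · filter_upwards [hs.mem_nhds hx₀] with x hx
    exact (slice hF x hx).aestronglyMeasurable
  · exact (slice hF x₀ hx₀).intervalIntegrable _ _
  · exact (slice hF' x₀ hx₀).aestronglyMeasurable
  · exact Eventually.of_forall fun θ hθ x hx => hM (x, θ) ⟨hx, uIoc_subset_uIcc hθ⟩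
  · exact intervalIntegrable_const
  · exact Eventually.of_forall fun θ _ x hx => hd x (hball hx) θ

/-- A solution of `f'' = q f` with `q > 0` on `(-∞, 0)` vanishes if `f f'` tends to `0` at both
ends. -/
lemma eq_zero_of_deriv_deriv_eq_mul {f f' q : ℝ → ℝ}
    (hf : ∀ t < 0, HasDerivAt f (f' t) t) (hf' : ∀ t < 0, HasDerivAt f' (q t * f t) t)
    (hq : ∀ t < 0, 0 < q t) (hbot : Tendsto (fun t => f t * f' t) atBot (𝓝 0))
    (hzero : Tendsto (fun t => f t * f' t) (𝓝[<] 0) (𝓝 0)) : ∀ t < 0, f t = 0 := by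
  have hd : ∀ t < 0, HasDerivAt (fun t => f t * f' t) (f' t * f' t + f t * (q t * f t)) t :=
    fun t ht => (hf t ht).mul (hf' t ht)
  -- The derivative of f f' is f'² + q f² ≥ 0. A monotone function with limit 0 at both ends is 0,
  -- and then q f² = 0.
  have hmono : MonotoneOn (fun t => f t * f' t) (Iio 0) := by
    apply monotoneOn_of_deriv_nonneg (convex_Iio 0)
    · exact fun t ht => (hd t ht).continuousAt.continuousWithinAt
    · rw [interior_Iio]
      exact fun t ht => (hd t ht).differentiableAt.differentiableWithinAt
    · rw [interior_Iio]
      intro t ht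
      rw [(hd t ht).deriv]
      have := hq t ht
      nlinarith [mul_nonneg this.le (mul_self_nonneg (f t)), mul_self_nonneg (f' t)]
  have h0 : ∀ t < 0, f t * f' t = 0 := by
    intro t ht
    apply le_antisymm
    · refine ge_of_tendsto hzero ?_
      filter_upwards [Ioo_mem_nhdsLT ht] with s hs
      exact hmono ht hs.2 hs.1.le
    · refine le_of_tendsto hbot ?_
      filter_upwards [eventually_le_atBot t] with s hs
      exact hmono (lt_of_le_of_lt hs ht) ht hs
  intro t ht
  have h1 : HasDerivAt (fun t => f t * f' t) 0 t := by
    refine (hasDerivAt_const t (0 : ℝ)).congr_of_eventuallyEq ?_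
    filter_upwards [Iio_mem_nhds ht] with s hs using h0 s hs
  have h2 := (hd t ht).unique h1
  have h3 := hq t ht
  have h4 : q t * (f t * f t) = 0 := by
    nlinarith [mul_nonneg h3.le (mul_self_nonneg (f t)), mul_self_nonneg (f' t)]
  rcases mul_eq_zero.1 h4 with h | h
  · exact absurd h h3.ne'
  · exact mul_self_eq_zero.1 h

/-- The point with logarithmic polar coordinates `t`, `θ`. -/
noncomputable def logPolar (t θ : ℝ) : ℂ :=
  Complex.exp (t + Complex.I * θ)

lemma norm_logPolar (t θ : ℝ) : ‖logPolar t θ‖ = Real.exp t := by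
  simp [logPolar, Complex.norm_exp]

lemma logPolar_mem_ball {t : ℝ} (ht : t < 0) (θ : ℝ) : logPolar t θ ∈ Metric.ball (0 : ℂ) 1 := by
  rw [mem_ball_zero_iff, norm_logPolar]
  exact (by simpa using Real.exp_lt_exp.2 ht)

lemma logPolar_mem_closedBall {t : ℝ} (ht : t ≤ 0) (θ : ℝ) :
    logPolar t θ ∈ Metric.closedBall (0 : ℂ) 1 := by
  rw [mem_closedBall_zero_iff, norm_logPolar]
  exact Real.exp_le_one_iff.2 ht

lemma continuous_logPolar : Continuous (fun x : ℝ × ℝ => logPolar x.1 x.2) := by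
  unfold logPolar
  fun_prop

lemma logPolar_add_two_pi (t θ : ℝ) : logPolar t (θ + 2 * Real.pi) = logPolar t θ := by
  unfold logPolar
  rw [← Complex.exp_periodic (t + Complex.I * θ)]
  congr 1
  push_cast
  ring

lemma hasDerivAt_logPolar_angle (t θ : ℝ) :
    HasDerivAt (logPolar t) (Complex.I * logPolar t θ) θ :=
  hasDerivAt_cexp_line t Complex.I θ

lemma hasDerivAt_logPolar_radius (t θ : ℝ) :
    HasDerivAt (fun t => logPolar t θ) (1 * logPolar t θ) t := by
  have h := hasDerivAt_cexp_line (Complex.I * θ) 1 t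
  simp only [one_mul, add_comm (Complex.I * (θ : ℂ))] at h ⊢
  exact h

section Mode

variable {δ γ : ℝ} {b : BoundaryCondition} {u : ℂ → ℝ}

lemma IsEigenSolution.continuousOn_fderiv {p : ℂ → ℝ} (h : IsEigenSolution p b γ u) :
    ContinuousOn (fderiv ℝ u) (Metric.ball 0 1) := fun _ hz =>
  ((h.contDiffAt hz).fderiv_right (m := 1) (by norm_num)).continuousAt.continuousWithinAt

lemma IsEigenSolution.continuousOn_fderiv_fderiv {p : ℂ → ℝ} (h : IsEigenSolution p b γ u) :
    ContinuousOn (fderiv ℝ (fderiv ℝ u)) (Metric.ball 0 1) := fun _ hz =>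
  (((h.contDiffAt hz).fderiv_right (m := 1) (by norm_num)).fderiv_right (m := 0)
    (by norm_num)).continuousAt.continuousWithinAt

lemma fderivWithin_closedBall_eq {z : ℂ} (hz : z ∈ Metric.ball (0 : ℂ) 1) :
    fderivWithin ℝ u (Metric.closedBall 0 1) z = fderiv ℝ u z :=
  fderivWithin_of_mem_nhds
    (mem_of_superset (Metric.isOpen_ball.mem_nhds hz) Metric.ball_subset_closedBall)

lemma IsEigenSolution.continuousOn_fderivWithin {p : ℂ → ℝ} (h : IsEigenSolution p b γ u) :
    ContinuousOn (fderivWithin ℝ u (Metric.closedBall 0 1)) (Metric.closedBall 0 1) :=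
  h.contDiffOn.continuousOn_fderivWithin uniqueDiffOn_disc (by norm_num)

/-- The eigenvalue equation in logarithmic polar coordinates. -/
lemma IsEigenSolution.equation_logPolar (hδ : 0 < δ)
    (h : IsEigenSolution (density δ) b γ u) {z : ℂ} (hz : z ∈ Metric.ball (0 : ℂ) 1) :
    ‖z‖ ^ 2 * Laplacian.laplacian u z =
      -(γ * alpha δ * (‖z‖ ^ 2 / (‖z‖ ^ 2 + δ))) * u z := by
  have h1 := h.equation z hz
  have h2 := alpha_pos hδ
  have h3 := norm_sq_add_pos hδ z
  rw [laplaceBeltrami, density] at h1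
  field_simp at h1 ⊢
  linear_combination ‖z‖ ^ 2 * h1

/-- A Fourier mode of positive frequency of an eigenfunction vanishes if the eigenvalue is
small. -/
lemma IsEigenSolution.integral_mul_eq_zero (hδ : 0 < δ)
    (h : IsEigenSolution (density δ) b γ u) (hγ : γ * alpha δ < 1 + δ) {χ χ' : ℝ → ℝ} {κ : ℝ}
    (hκ : 1 ≤ κ) (hχ : ∀ θ, HasDerivAt χ (χ' θ) θ) (hχ' : ∀ θ, HasDerivAt χ' (-(κ * χ θ)) θ)
    (hper : χ (2 * Real.pi) = χ 0) (hper' : χ' (2 * Real.pi) = χ' 0) :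
    ∀ t < 0, ∫ θ in (0 : ℝ)..2 * Real.pi, u (logPolar t θ) * χ θ = 0 := by
  have hχc : Continuous χ := continuous_iff_continuousAt.2 fun θ => (hχ θ).continuousAt
  have hχ'c : Continuous χ' := continuous_iff_continuousAt.2 fun θ => (hχ' θ).continuousAt
  have hmap : MapsTo (fun x : ℝ × ℝ => logPolar x.1 x.2) (Iio 0 ×ˢ univ)
      (Metric.ball (0 : ℂ) 1) := fun x hx => logPolar_mem_ball hx.1 x.2
  have hc := continuous_logPolar.continuousOn (s := Iio 0 ×ˢ univ)
  have hud : ∀ t < 0, ∀ θ, DifferentiableAt ℝ u (logPolar t θ) := fun t ht θ =>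
    (h.contDiffAt (logPolar_mem_ball ht θ)).differentiableAt (by norm_num)
  have hu0 : ContinuousOn (fun x : ℝ × ℝ => u (logPolar x.1 x.2)) (Iio 0 ×ˢ univ) :=
    (h.contDiffOn.continuousOn.mono Metric.ball_subset_closedBall).comp hc hmap
  have hu1 : ContinuousOn (fun x : ℝ × ℝ => fderiv ℝ u (logPolar x.1 x.2)) (Iio 0 ×ˢ univ) :=
    h.continuousOn_fderiv.comp hc hmap
  have hu2 : ContinuousOn (fun x : ℝ × ℝ => fderiv ℝ (fderiv ℝ u) (logPolar x.1 x.2))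
      (Iio 0 ×ˢ univ) := h.continuousOn_fderiv_fderiv.comp hc hmap
  have hχ2 : ContinuousOn (fun x : ℝ × ℝ => χ x.2) (Iio 0 ×ˢ univ) := by fun_prop
  set f : ℝ → ℝ := fun t => ∫ θ in (0 : ℝ)..2 * Real.pi, u (logPolar t θ) * χ θ with hf
  set f' : ℝ → ℝ := fun t => ∫ θ in (0 : ℝ)..2 * Real.pi,
    fderiv ℝ u (logPolar t θ) (1 * logPolar t θ) * χ θ with hf'
  -- The term κ comes from −∂_θ² acting on χ, the other from the eigenvalue equation multiplied by
  -- r².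
  set q : ℝ → ℝ := fun t => κ - γ * alpha δ * (Real.exp t ^ 2 / (Real.exp t ^ 2 + δ)) with hq
  have hdf : ∀ t < 0, HasDerivAt f (f' t) t := by
    intro t ht
    refine hasDerivAt_intervalIntegral_of_continuousOn
      (F := (fun t θ => u (logPolar t θ) * χ θ))
      (F' := (fun t θ => fderiv ℝ u (logPolar t θ) (1 * logPolar t θ) * χ θ))
      isOpen_Iio (hu0.mul hχ2)
      ((hu1.clm_apply (continuousOn_const.mul hc)).mul hχ2) ?_ ht
    intro x hx θ
    exact (hasDerivAt_comp_spiral (c := fun t => logPolar t θ) (hud x hx θ)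
      (hasDerivAt_logPolar_radius x θ)).mul_const _
  have hdf' : ∀ t < 0, HasDerivAt f' (q t * f t) t := by
    intro t ht
    have h1 := hasDerivAt_intervalIntegral_of_continuousOn
      (F := (fun t θ => fderiv ℝ u (logPolar t θ) (1 * logPolar t θ) * χ θ))
      (F' := (fun t θ => (fderiv ℝ (fderiv ℝ u) (logPolar t θ) (1 * logPolar t θ) (1 * logPolar t θ) +
        fderiv ℝ u (logPolar t θ) (1 * (1 * logPolar t θ))) * χ θ))
      isOpen_Iio (a := 0) (b := 2 * Real.pi)
      ((hu1.clm_apply (continuousOn_const.mul hc)).mul hχ2)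
      ((((hu2.clm_apply (continuousOn_const.mul hc)).clm_apply (continuousOn_const.mul hc)).add
        (hu1.clm_apply (continuousOn_const.mul (continuousOn_const.mul hc)))).mul hχ2)
      (fun x hx θ => (hasDerivAt_fderiv_spiral (c := fun t => logPolar t θ)
        (h.contDiffAt (logPolar_mem_ball hx θ)) (hasDerivAt_logPolar_radius x θ)).mul_const _) ht
    convert! h1 using 1
    have slice : ∀ {E : Type} [TopologicalSpace E] {H : ℝ → ℝ → E},
        ContinuousOn (fun x : ℝ × ℝ => H x.1 x.2) (Iio 0 ×ˢ univ) → Continuous (H t) := by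
      intro E _ H hH
      rw [← continuousOn_univ]
      exact hH.comp (f := fun θ => (t, θ)) (by fun_prop) (fun θ _ => ⟨ht, mem_univ _⟩)
    have c0 : Continuous fun θ => logPolar t θ := slice hc
    have c1 : Continuous fun θ => u (logPolar t θ) := slice (H := fun t θ => u (logPolar t θ)) hu0
    have c2 : Continuous fun θ => fderiv ℝ u (logPolar t θ) :=
      slice (H := fun t θ => fderiv ℝ u (logPolar t θ)) hu1
    have c3 : Continuous fun θ => fderiv ℝ (fderiv ℝ u) (logPolar t θ) :=
      slice (H := fun t θ => fderiv ℝ (fderiv ℝ u) (logPolar t θ)) hu2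
    set v' : ℝ → ℝ := fun θ => fderiv ℝ u (logPolar t θ) (Complex.I * logPolar t θ)
    set v'' : ℝ → ℝ := fun θ => fderiv ℝ (fderiv ℝ u) (logPolar t θ) (Complex.I * logPolar t θ)
        (Complex.I * logPolar t θ) +
      fderiv ℝ u (logPolar t θ) (Complex.I * (Complex.I * logPolar t θ)) with hv''
    have hv : ∀ θ, HasDerivAt (fun θ => u (logPolar t θ)) (v' θ) θ := fun θ =>
      hasDerivAt_comp_spiral (hud t ht θ) (hasDerivAt_logPolar_angle t θ)
    have hv' : ∀ θ, HasDerivAt v' (v'' θ) θ := fun θ =>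
      hasDerivAt_fderiv_spiral (h.contDiffAt (logPolar_mem_ball ht θ))
        (hasDerivAt_logPolar_angle t θ)
    have cv' : Continuous v' := c2.clm_apply (continuous_const.mul c0)
    have cv'' : Continuous v'' :=
      ((c3.clm_apply (continuous_const.mul c0)).clm_apply (continuous_const.mul c0)).add
        (c2.clm_apply (continuous_const.mul (continuous_const.mul c0)))
    have hend : logPolar t (2 * Real.pi) = logPolar t 0 := by
      simpa using logPolar_add_two_pi t 0
    -- Two integrations by parts move ∂_θ² from u to χ; the boundary terms cancel by periodicity.
    have p1 := intervalIntegral.integral_deriv_mul_eq_sub (a := 0) (b := 2 * Real.pi)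
      (fun θ _ => hv' θ) (fun θ _ => hχ θ)
      (cv''.intervalIntegrable _ _) (hχ'c.intervalIntegrable _ _)
    have p2 := intervalIntegral.integral_deriv_mul_eq_sub (a := 0) (b := 2 * Real.pi)
      (fun θ _ => hv θ) (fun θ _ => hχ' θ)
      (cv'.intervalIntegrable _ _)
      ((continuous_const.mul hχc).neg.intervalIntegrable _ _)
    have e1 : v' (2 * Real.pi) = v' 0 := by simp only [v', hend]
    simp only [e1, hper, hper', hend, sub_self] at p1 p2
    have hI1 : IntervalIntegrable (fun θ => v'' θ * χ θ + v' θ * χ' θ) volume 0 (2 * Real.pi) :=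
      ((cv''.mul hχc).add (cv'.mul hχ'c)).intervalIntegrable _ _
    have hI2 : IntervalIntegrable (fun θ => v' θ * χ' θ + u (logPolar t θ) * -(κ * χ θ)) volume 0
        (2 * Real.pi) :=
      ((cv'.mul hχ'c).add (c1.mul (continuous_const.mul hχc).neg)).intervalIntegrable _ _
    have hsum : ∫ θ in (0 : ℝ)..2 * Real.pi,
        ((v'' θ * χ θ + v' θ * χ' θ) - (v' θ * χ' θ + u (logPolar t θ) * -(κ * χ θ))) = 0 := by
      rw [intervalIntegral.integral_sub hI1 hI2, p1, p2, sub_self]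
    have hcUχ : Continuous fun θ => u (logPolar t θ) * χ θ := c1.mul hχc
    rw [show f t = ∫ θ in (0 : ℝ)..2 * Real.pi, u (logPolar t θ) * χ θ from rfl,
      ← intervalIntegral.integral_const_mul, ← sub_eq_zero,
      ← intervalIntegral.integral_sub, ← hsum]
    · congr 1
      funext θ
      have l1 := fderiv_fderiv_add_rotate u (logPolar t θ) (logPolar t θ)
      have l2 := h.equation_logPolar hδ (logPolar_mem_ball ht θ)
      rw [l2, norm_logPolar] at l1
      have h3 : Complex.I * (Complex.I * logPolar t θ) = -logPolar t θ := by
        rw [← mul_assoc, Complex.I_mul_I, neg_one_mul]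
      simp only [hv'', h3, map_neg, one_mul, hq]
      linear_combination (-χ θ) * l1
    · exact (continuous_const.mul hcUχ).intervalIntegrable _ _
    · refine Continuous.intervalIntegrable ?_ _ _
      exact ((((c3.clm_apply (continuous_const.mul c0)).clm_apply (continuous_const.mul c0)).add
        (c2.clm_apply (continuous_const.mul (continuous_const.mul c0))))).mul hχc
  -- On t < 0 the potential w is below 1/(1+δ), so γα w < 1 ≤ κ. When γ is negative the same
  -- estimate holds.
  have hqpos : ∀ t < 0, 0 < q t := by
    intro t ht
    have h1 : 0 < Real.exp t ^ 2 := by positivity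
    have h2 : Real.exp t ^ 2 < 1 := pow_lt_one₀ (Real.exp_pos t).le ((by simpa using Real.exp_lt_exp.2 ht)) two_ne_zero
    have h3 : Real.exp t ^ 2 / (Real.exp t ^ 2 + δ) < 1 / (1 + δ) := by
      rw [div_lt_div_iff₀ (by positivity) (by positivity)]
      nlinarith
    have h4 : γ * alpha δ * (Real.exp t ^ 2 / (Real.exp t ^ 2 + δ)) ≤
        (1 + δ) * (Real.exp t ^ 2 / (Real.exp t ^ 2 + δ)) := by gcongr
    have h5 : (1 + δ) * (Real.exp t ^ 2 / (Real.exp t ^ 2 + δ)) < (1 + δ) * (1 / (1 + δ)) := by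
      gcongr
    have h6 : (1 + δ) * (1 / (1 + δ)) = 1 := by field_simp
    simp only [hq]
    linarith
  -- Clamping t at 0 keeps the point in the closed disc, so the modes of u and of its radial
  -- derivative extend to functions g, g' continuous on the whole line. Their values at 0 are the
  -- boundary data.
  have hmin : MapsTo (fun x : ℝ × ℝ => logPolar (min x.1 0) x.2) univ
      (Metric.closedBall (0 : ℂ) 1) := fun x _ => logPolar_mem_closedBall (min_le_right _ _) x.2
  have cmin : Continuous fun x : ℝ × ℝ => logPolar (min x.1 0) x.2 :=
    continuous_logPolar.comp (by fun_prop : Continuous fun x : ℝ × ℝ => (min x.1 0, x.2))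
  have cu : Continuous fun x : ℝ × ℝ => u (logPolar (min x.1 0) x.2) := by
    rw [← continuousOn_univ]
    exact h.contDiffOn.continuousOn.comp cmin.continuousOn hmin
  have cdu : Continuous fun x : ℝ × ℝ =>
      fderivWithin ℝ u (Metric.closedBall 0 1) (logPolar (min x.1 0) x.2) := by
    rw [← continuousOn_univ]
    exact h.continuousOn_fderivWithin.comp cmin.continuousOn hmin
  set g : ℝ → ℝ := fun t => ∫ θ in (0 : ℝ)..2 * Real.pi, u (logPolar (min t 0) θ) * χ θ with hg
  set g' : ℝ → ℝ := fun t => ∫ θ in (0 : ℝ)..2 * Real.pi,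
    fderivWithin ℝ u (Metric.closedBall 0 1) (logPolar (min t 0) θ) (logPolar (min t 0) θ) * χ θ
    with hg'
  have cχ2 : Continuous fun x : ℝ × ℝ => χ x.2 := by fun_prop
  have cg : Continuous g := by
    refine intervalIntegral.continuous_parametric_intervalIntegral_of_continuous'
      (f := fun t θ => u (logPolar (min t 0) θ) * χ θ) (cu.mul cχ2) _ _
  have cg' : Continuous g' :=
    intervalIntegral.continuous_parametric_intervalIntegral_of_continuous'
      (f := fun t θ => fderivWithin ℝ u (Metric.closedBall 0 1) (logPolar (min t 0) θ)
        (logPolar (min t 0) θ) * χ θ) ((cdu.clm_apply cmin).mul cχ2) _ _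
  have hfg : ∀ t < 0, f t = g t := fun t ht => by simp only [hf, hg, min_eq_left ht.le]
  have hfg' : ∀ t < 0, f' t = g' t := fun t ht => by
    simp only [hf', hg', min_eq_left ht.le, one_mul]
    congr 1
    funext θ
    rw [fderivWithin_closedBall_eq (logPolar_mem_ball ht θ)]
  refine eq_zero_of_deriv_deriv_eq_mul hdf hdf' hqpos ?_ ?_
  -- At the centre f stays bounded while f' = O(e^t), since the derivative of u is applied to a
  -- vector of length e^t.
  · obtain ⟨M, hM⟩ := (isCompact_closedBall (0 : ℂ) 1).exists_bound_of_continuousOn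
      h.contDiffOn.continuousOn
    obtain ⟨M', hM'⟩ := (isCompact_closedBall (0 : ℂ) 1).exists_bound_of_continuousOn
      h.continuousOn_fderivWithin
    obtain ⟨X, hX⟩ := (isCompact_uIcc (a := (0 : ℝ)) (b := 2 * Real.pi)).exists_bound_of_continuousOn
      hχc.continuousOn
    have hM0 : 0 ≤ M := (norm_nonneg _).trans (hM 0 (by simp))
    have hM0' : 0 ≤ M' := (norm_nonneg _).trans (hM' 0 (by simp))
    have b1 : ∀ t < 0, |f t| ≤ M * X * (2 * Real.pi) := by
      intro t ht
      have := intervalIntegral.norm_integral_le_of_norm_le_const (a := 0) (b := 2 * Real.pi)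
        (f := fun θ => u (logPolar t θ) * χ θ) (C := M * X) (fun θ hθ => by
          rw [norm_mul]
          exact mul_le_mul (hM _ (logPolar_mem_closedBall ht.le θ)) (hX θ (uIoc_subset_uIcc hθ))
            (norm_nonneg _) hM0)
      rwa [sub_zero, abs_of_pos Real.two_pi_pos] at this
    have b2 : ∀ t < 0, |f' t| ≤ M' * Real.exp t * X * (2 * Real.pi) := by
      intro t ht
      have := intervalIntegral.norm_integral_le_of_norm_le_const (a := 0) (b := 2 * Real.pi)
        (f := fun θ => fderiv ℝ u (logPolar t θ) (1 * logPolar t θ) * χ θ)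
        (C := M' * Real.exp t * X) (fun θ hθ => by
          rw [norm_mul]
          refine mul_le_mul ?_ (hX θ (uIoc_subset_uIcc hθ)) (norm_nonneg _) (by positivity)
          refine (ContinuousLinearMap.le_opNorm _ _).trans ?_
          rw [one_mul, norm_logPolar, ← fderivWithin_closedBall_eq (logPolar_mem_ball ht θ)]
          gcongr
          exact hM' _ (logPolar_mem_closedBall ht.le θ))
      rwa [sub_zero, abs_of_pos Real.two_pi_pos] at this
    have hb : Tendsto (fun t => (M * X * (2 * Real.pi)) * (M' * Real.exp t * X * (2 * Real.pi)))
        atBot (𝓝 0) := by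
      have := Real.tendsto_exp_atBot.const_mul
        ((M * X * (2 * Real.pi)) * (M' * X * (2 * Real.pi)))
      rw [mul_zero] at this
      refine this.congr fun t => by ring
    refine squeeze_zero_norm' ?_ hb
    filter_upwards [eventually_lt_atBot 0] with t ht
    rw [norm_mul]
    exact mul_le_mul (b1 t ht) (b2 t ht) (norm_nonneg _) ((abs_nonneg _).trans (b1 t ht))
  -- At the boundary one factor vanishes: g for Dirichlet, g' for Neumann.
  · have hlim : Tendsto (fun t => g t * g' t) (𝓝[<] 0) (𝓝 (g 0 * g' 0)) :=
      ((cg.mul cg').tendsto 0).mono_left nhdsWithin_le_nhds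
    have h0 : g 0 * g' 0 = 0 := by
      have hs : ∀ θ, logPolar (min 0 0) θ ∈ Metric.sphere (0 : ℂ) 1 := fun θ => by
        rw [mem_sphere_zero_iff_norm, norm_logPolar]
        simp
      have hb := h.boundary
      cases b with
      | dirichlet =>
        have : ∀ θ, u (logPolar (min 0 0) θ) = 0 := fun θ => hb _ (hs θ)
        simp only [hg, this]
        simp
      | neumann =>
        have : ∀ θ, fderivWithin ℝ u (Metric.closedBall 0 1) (logPolar (min 0 0) θ)
          (logPolar (min 0 0) θ) = 0 := fun θ => hb _ (hs θ)
        simp only [hg', this]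
        simp
    rw [h0] at hlim
    refine hlim.congr' ?_
    filter_upwards [self_mem_nhdsWithin] with t ht
    rw [← hfg t ht, ← hfg' t ht]

end Mode

/-! ### Lower bounds for the non-invariant spectrum -/

/-- A continuous `2π`-periodic function all of whose nonconstant Fourier modes vanish is
constant. -/
lemma eq_const_of_integral_mul_cos_sin_eq_zero {h : ℝ → ℝ} (hc : Continuous h)
    (hp : Function.Periodic h (2 * Real.pi))
    (hcos : ∀ k : ℕ, 1 ≤ k → ∫ θ in (0 : ℝ)..2 * Real.pi, h θ * Real.cos (k * θ) = 0)
    (hsin : ∀ k : ℕ, 1 ≤ k → ∫ θ in (0 : ℝ)..2 * Real.pi, h θ * Real.sin (k * θ) = 0)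
    (x y : ℝ) : h x = h y := by
  have : Fact (0 < 2 * Real.pi) := ⟨Real.two_pi_pos⟩
  have hp' : Function.Periodic (fun x => (h x : ℂ)) (2 * Real.pi) := fun x => by simp [hp x]
  have hcl : Continuous (hp'.lift : AddCircle (2 * Real.pi) → ℂ) :=
    continuous_coinduced_dom.2 (Complex.continuous_ofReal.comp hc)
  let F : C(AddCircle (2 * Real.pi), ℂ) := ⟨hp'.lift, hcl⟩
  have hF : ∀ x : ℝ, F (x : AddCircle (2 * Real.pi)) = h x := fun x => hp'.lift_coe x
  have hint : ∀ k : ℤ, k ≠ 0 →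
      (∫ θ in (0 : ℝ)..2 * Real.pi, h θ * Real.cos (k * θ) = 0) ∧
      (∫ θ in (0 : ℝ)..2 * Real.pi, h θ * Real.sin (k * θ) = 0) := by
    intro k hk
    have hn : 1 ≤ k.natAbs := Nat.one_le_iff_ne_zero.2 (Int.natAbs_ne_zero.2 hk)
    rcases Int.natAbs_eq k with h1 | h1
    · rw [h1]
      exact ⟨by simpa using hcos _ hn, by simpa using hsin _ hn⟩
    · rw [h1]
      have h2 := hcos _ hn
      have h3 := hsin _ hn
      constructor
      · simpa only [Int.cast_neg, Int.cast_natCast, neg_mul, Real.cos_neg] using h2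
      · simp only [Int.cast_neg, Int.cast_natCast, neg_mul, Real.sin_neg, mul_neg,
          intervalIntegral.integral_neg, h3, neg_zero]
  have hcoeff : ∀ n : ℤ, n ≠ 0 → fourierCoeff F n = 0 := by
    intro n hn
    rw [fourierCoeff_eq_intervalIntegral _ _ 0, zero_add]
    have e : ∀ x : ℝ, fourier (-n) (x : AddCircle (2 * Real.pi)) • F (x : AddCircle (2 * Real.pi)) =
        ((h x * Real.cos ((-n : ℤ) * x) : ℝ) : ℂ) +
          Complex.I * ((h x * Real.sin ((-n : ℤ) * x) : ℝ) : ℂ) := by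
      intro x
      have hpi : (Real.pi : ℂ) ≠ 0 := by exact_mod_cast Real.pi_ne_zero
      have e1 : (2 * (Real.pi : ℂ) * Complex.I * ((-n : ℤ) : ℂ) * x / ((2 * Real.pi : ℝ) : ℂ)) =
          (((-n : ℤ) * x : ℝ) : ℂ) * Complex.I := by
        push_cast
        field_simp
      rw [hF, fourier_coe_apply, e1, Complex.exp_mul_I, ← Complex.ofReal_cos, ← Complex.ofReal_sin,
        smul_eq_mul]
      push_cast
      ring
    simp_rw [e]
    have c1 : Continuous fun x : ℝ => ((h x * Real.cos ((-n : ℤ) * x) : ℝ) : ℂ) := by fun_prop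
    have c2 : Continuous fun x : ℝ =>
      Complex.I * ((h x * Real.sin ((-n : ℤ) * x) : ℝ) : ℂ) := by fun_prop
    rw [intervalIntegral.integral_add (c1.intervalIntegrable _ _) (c2.intervalIntegrable _ _),
      intervalIntegral.integral_const_mul, intervalIntegral.integral_ofReal,
      intervalIntegral.integral_ofReal, (hint (-n) (neg_ne_zero.2 hn)).1,
      (hint (-n) (neg_ne_zero.2 hn)).2]
    simp
  -- Only one coefficient survives, so the Fourier series is summable and represents the function at
  -- every point.
  have hsum : Summable (fourierCoeff F) :=
    summable_of_ne_finset_zero (s := {0}) fun n hn => hcoeff n (by simpa using hn)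
  have key : ∀ x : ℝ, (h x : ℂ) = fourierCoeff F 0 := by
    intro x
    have h1 := has_pointwise_sum_fourier_series_of_summable hsum (x : AddCircle (2 * Real.pi))
    rw [hF] at h1
    have h2 := hasSum_single (f := fun i : ℤ => fourierCoeff F i •
      fourier i (x : AddCircle (2 * Real.pi))) 0 fun n hn => by simp [hcoeff n hn]
    simpa using h1.unique h2
  exact_mod_cast (key x).trans (key y).symm

/-- The modes cos kθ and sin kθ with k ≥ 1 have κ = k² ≥ 1 and vanish, so u is constant on each
circle inside the disc. Continuity covers the boundary circle, and off the disc u is 0 by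
convention. -/
lemma IsEigenSolution.isRotationInvariant_of_lt {δ γ : ℝ} {b : BoundaryCondition} {u : ℂ → ℝ}
    (hδ : 0 < δ) (h : IsEigenSolution (density δ) b γ u) (hγ : γ * alpha δ < 1 + δ) :
    IsRotationInvariant u := by
  have hball : ∀ t < 0, ∀ θ θ', u (logPolar t θ) = u (logPolar t θ') := by
    intro t ht
    have hcont : Continuous fun θ => u (logPolar t θ) := by
      rw [← continuousOn_univ]
      refine h.contDiffOn.continuousOn.comp (f := fun θ => logPolar t θ)
        (continuous_logPolar.comp (by fun_prop : Continuous fun θ : ℝ => (t, θ))).continuousOn ?_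
      exact fun θ _ => logPolar_mem_closedBall ht.le θ
    have dcos : ∀ (k : ℕ) (θ : ℝ),
        HasDerivAt (fun θ => Real.cos (k * θ)) (-(k * Real.sin (k * θ))) θ := fun k θ => by
      have := (Real.hasDerivAt_cos (k * θ)).comp θ ((hasDerivAt_id θ).const_mul (k : ℝ))
      convert! this using 1
      simp
      ring
    have dsin : ∀ (k : ℕ) (θ : ℝ),
        HasDerivAt (fun θ => Real.sin (k * θ)) (k * Real.cos (k * θ)) θ := fun k θ => by
      have := (Real.hasDerivAt_sin (k * θ)).comp θ ((hasDerivAt_id θ).const_mul (k : ℝ))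
      convert! this using 1
      simp
      ring
    have pcos : ∀ k : ℕ, Real.cos (k * (2 * Real.pi)) = Real.cos (k * 0) := fun k => by simp
    have psin : ∀ k : ℕ, Real.sin (k * (2 * Real.pi)) = Real.sin (k * 0) := fun k => by
      have := Real.sin_nat_mul_pi (2 * k)
      push_cast at this
      rw [mul_zero, Real.sin_zero, ← this]
      congr 1
      ring
    have hk2 : ∀ k : ℕ, 1 ≤ k → (1 : ℝ) ≤ (k : ℝ) ^ 2 := fun k hk =>
      one_le_pow₀ (by exact_mod_cast hk)
    refine eq_const_of_integral_mul_cos_sin_eq_zero hcont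
      (fun θ => by simp only [logPolar_add_two_pi]) ?_ ?_
    · intro k hk
      refine h.integral_mul_eq_zero hδ hγ (χ' := fun θ => -(k * Real.sin (k * θ))) (hk2 k hk)
        (dcos k) (fun θ => ?_) (pcos k) (by simp only [psin k]) t ht
      convert! ((dsin k θ).const_mul (k : ℝ)).neg using 1
      ring
    · intro k hk
      refine h.integral_mul_eq_zero hδ hγ (χ' := fun θ => k * Real.cos (k * θ)) (hk2 k hk)
        (dsin k) (fun θ => ?_) (psin k) (by simp only [pcos k]) t ht
      convert! (dcos k θ).const_mul (k : ℝ) using 1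
      ring
  have hpolar : ∀ z : ℂ, z ≠ 0 → z = logPolar (Real.log ‖z‖) z.arg := by
    intro z hz
    rw [logPolar, Complex.exp_add, ← Complex.ofReal_exp, Real.exp_log (norm_pos_iff.2 hz),
      mul_comm Complex.I]
    exact (Complex.norm_mul_exp_arg_mul_I z).symm
  have hopen : ∀ (c : Circle), ∀ z ∈ Metric.ball (0 : ℂ) 1, u (c * z) = u z := by
    intro c z hz
    rcases eq_or_ne z 0 with rfl | h0
    · simp
    have hcz : ‖(c : ℂ) * z‖ = ‖z‖ := by rw [norm_mul, Circle.norm_coe, one_mul]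
    have h1 : (c : ℂ) * z ≠ 0 := by
      rw [← norm_ne_zero_iff, hcz]
      exact norm_ne_zero_iff.2 h0
    have ht : Real.log ‖z‖ < 0 :=
      Real.log_neg (norm_pos_iff.2 h0) (by simpa using hz)
    rw [hpolar _ h1, hcz]
    conv_rhs => rw [hpolar z h0]
    exact hball _ ht _ _
  intro c z
  by_cases hz : z ∈ Metric.closedBall (0 : ℂ) 1
  · have hcl : Metric.closedBall (0 : ℂ) 1 ⊆ closure (Metric.ball (0 : ℂ) 1) := by
      rw [closure_ball _ one_ne_zero]
    have hcont := h.contDiffOn.continuousOn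
    have hm : MapsTo (fun z : ℂ => (c : ℂ) * z) (Metric.closedBall 0 1)
        (Metric.closedBall 0 1) := fun y hy => by
      rw [mem_closedBall_zero_iff] at hy ⊢
      rwa [norm_mul, Circle.norm_coe, one_mul]
    have hcont2 : ContinuousOn (fun z => u (c * z)) (Metric.closedBall 0 1) :=
      hcont.comp (by fun_prop) hm
    exact EqOn.of_subset_closure (fun z hz => hopen c z hz) hcont2 hcont
      Metric.ball_subset_closedBall hcl hz
  · rw [h.off_disc z hz, h.off_disc]
    rw [mem_closedBall_zero_iff] at hz ⊢
    rwa [norm_mul, Circle.norm_coe, one_mul]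

/-- Lower bound for the non-invariant spectrum. -/
lemma le_of_mem_nonInvariantSpectrum {δ γ : ℝ} {b : BoundaryCondition} (hδ : 0 < δ)
    (hγ : γ ∈ nonInvariantSpectrum (density δ) b) : (1 + δ) * (1 / alpha δ) ≤ γ := by
  obtain ⟨u, hu, hinv⟩ := hγ
  by_contra! hlt
  refine hinv (hu.isRotationInvariant_of_lt hδ ?_)
  rwa [mul_one_div, lt_div_iff₀ (alpha_pos hδ)] at hlt

lemma one_div_alpha_le_of_mem_nonInvariantSpectrum {δ γ : ℝ} {b : BoundaryCondition} (hδ : 0 < δ)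
    (hγ : γ ∈ nonInvariantSpectrum (density δ) b) : 1 / alpha δ ≤ γ := by
  have h1 := le_of_mem_nonInvariantSpectrum hδ hγ
  have h2 := one_div_pos.2 (alpha_pos hδ)
  nlinarith

/-- The factor 1 + δ is essential, because 1/α alone tends to 0 as δ → ∞. At x = (1+δ)/δ the
inequality log x ≥ 1 − 1/x has right side 1/(1+δ), which this factor cancels. -/
lemma one_le_of_mem_nonInvariantSpectrum {δ γ : ℝ} {b : BoundaryCondition} (hδ : 0 < δ)
    (hγ : γ ∈ nonInvariantSpectrum (density δ) b) : 1 ≤ γ := by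
  refine le_trans ?_ (le_of_mem_nonInvariantSpectrum hδ hγ)
  rw [one_div_alpha]
  have h1 := Real.one_sub_inv_le_log_of_pos (x := (1 + δ) / δ) (by positivity)
  calc (1 : ℝ) = (1 + δ) * (1 - ((1 + δ) / δ)⁻¹) := by field_simp; ring
    _ ≤ _ := by gcongr

/-! ### Power series with coefficients of polynomial growth -/

/-- The sum of the power series with coefficients `c`. -/
noncomputable def powerSum (c : ℕ → ℝ) (w : ℝ) : ℝ :=
  ∑' n, c n * w ^ n

/-- The coefficients are bounded by a polynomial in the index. -/
def HasPolyGrowth (c : ℕ → ℝ) : Prop :=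
  ∃ (N : ℕ) (K : ℝ), ∀ n, |c n| ≤ K * ((n + N).choose N : ℝ)

/-- A factor n + 1 is absorbed by raising the degree N of the growth bound by one; this makes
polynomial growth stable under termwise differentiation. -/
lemma succ_mul_choose (n N : ℕ) :
    ((n : ℝ) + 1) * ((n + 1 + N).choose N : ℝ) = (N + 1) * ((n + (N + 1)).choose (N + 1) : ℝ) := by
  have h := Nat.choose_succ_right_eq (n + 1 + N) N
  rw [Nat.add_sub_cancel] at h
  have h2 : n + 1 + N = n + (N + 1) := by ring
  rw [← h2]
  have h3 : (((n + 1 + N).choose (N + 1) * (N + 1) : ℕ) : ℝ) =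
    ((n + 1 + N).choose N * (n + 1) : ℕ) := by rw [h]
  push_cast at h3
  linarith

lemma choose_le_choose_succ (n N : ℕ) :
    ((n + N).choose N : ℝ) ≤ ((n + 1 + N).choose N : ℝ) := by
  exact_mod_cast Nat.choose_le_choose N (by lia)

namespace HasPolyGrowth

variable {c : ℕ → ℝ}

lemma deriv (h : HasPolyGrowth c) : HasPolyGrowth fun n => (n + 1) * c (n + 1) := by
  obtain ⟨N, K, hK⟩ := h
  refine ⟨N + 1, K * (N + 1), fun n => ?_⟩
  rw [abs_mul, abs_of_nonneg (by positivity), mul_assoc, ← succ_mul_choose]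
  calc ((n : ℝ) + 1) * |c (n + 1)| ≤ (n + 1) * (K * ((n + 1 + N).choose N : ℝ)) := by
        gcongr
        exact hK (n + 1)
    _ = _ := by ring

lemma succ_mul (h : HasPolyGrowth c) : HasPolyGrowth fun n => (n + 1) * c n := by
  obtain ⟨N, K, hK⟩ := h
  have hK0 : 0 ≤ K := by simpa using (abs_nonneg _).trans (hK 0)
  refine ⟨N + 1, K * (N + 1), fun n => ?_⟩
  rw [abs_mul, abs_of_nonneg (by positivity), mul_assoc, ← succ_mul_choose]
  calc ((n : ℝ) + 1) * |c n| ≤ (n + 1) * (K * ((n + 1 + N).choose N : ℝ)) := by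
        gcongr
        exact (hK n).trans (mul_le_mul_of_nonneg_left (choose_le_choose_succ n N) hK0)
    _ = _ := by ring

lemma summable_abs (h : HasPolyGrowth c) {r : ℝ} (h0 : 0 ≤ r) (h1 : r < 1) :
    Summable fun n => |c n| * r ^ n := by
  obtain ⟨N, K, hK⟩ := h
  have hs := (summable_choose_mul_geometric_of_norm_lt_one (R := ℝ) N (r := r)
    (by rwa [Real.norm_eq_abs, abs_of_nonneg h0])).mul_left K
  refine Summable.of_nonneg_of_le (fun n => by positivity) (fun n => ?_) hs
  rw [← mul_assoc]
  gcongr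
  exact hK n

lemma summable (h : HasPolyGrowth c) {w : ℝ} (hw : |w| < 1) : Summable fun n => c n * w ^ n := by
  refine (h.summable_abs (abs_nonneg w) hw).of_norm_bounded fun n => ?_
  rw [norm_mul, norm_pow]
  rfl

/-- With |w| < r < 1 the differentiated series is dominated on (−r, r) by its values at r, so
termwise differentiation applies. -/
lemma hasDerivAt (h : HasPolyGrowth c) {w : ℝ} (hw : |w| < 1) :
    HasDerivAt (powerSum c) (powerSum (fun n => (n + 1) * c (n + 1)) w) w := by
  obtain ⟨r, hr, hr1⟩ := exists_between hw
  have hr0 : 0 < r := (abs_nonneg w).trans_lt hr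
  have hsum : Summable fun n : ℕ => |c n| * (n * r ^ (n - 1)) := by
    rw [← summable_nat_add_iff 1]
    refine (h.deriv.summable_abs hr0.le hr1).congr fun n => ?_
    rw [abs_mul, abs_of_nonneg (by positivity : (0 : ℝ) ≤ n + 1)]
    push_cast
    ring
  have key := hasDerivAt_tsum_of_isPreconnected (g := fun n w => c n * w ^ n)
    (g' := fun n w => c n * (n * w ^ (n - 1))) (t := Ioo (-r) r) (y₀ := 0) (y := w) hsum isOpen_Ioo
    isPreconnected_Ioo (fun n y _ => (hasDerivAt_pow n y).const_mul (c n)) (fun n y hy => by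
      rw [norm_mul, norm_mul, norm_pow, Real.norm_natCast, Real.norm_eq_abs, Real.norm_eq_abs]
      have : |y| ≤ r := (abs_lt.2 hy).le
      gcongr) ⟨by linarith, hr0⟩ (h.summable (by simp)) (abs_lt.1 hr)
  convert! key using 1
  rw [powerSum, Summable.tsum_eq_zero_add (f := fun n => c n * (n * w ^ (n - 1)))]
  · simp only [Nat.cast_zero, zero_mul, mul_zero, zero_add, Nat.add_sub_cancel]
    refine tsum_congr fun n => ?_
    push_cast
    ring
  · refine hsum.of_norm_bounded fun n => ?_
    rw [norm_mul, norm_mul, norm_pow, Real.norm_natCast, Real.norm_eq_abs, Real.norm_eq_abs]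
    gcongr

lemma contDiffOn (h : HasPolyGrowth c) (m : ℕ) : ContDiffOn ℝ m (powerSum c) (Ioo (-1) 1) := by
  induction m generalizing c with
  | zero =>
    rw [Nat.cast_zero, contDiffOn_zero]
    exact fun w hw => (h.hasDerivAt (abs_lt.2 hw)).continuousAt.continuousWithinAt
  | succ m ih =>
    rw [Nat.cast_succ, contDiffOn_succ_iff_deriv_of_isOpen isOpen_Ioo]
    refine ⟨fun w hw => (h.hasDerivAt (abs_lt.2 hw)).differentiableAt.differentiableWithinAt,
      by simp, ?_⟩
    exact (ih h.deriv).congr fun w hw => (h.hasDerivAt (abs_lt.2 hw)).deriv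

/-- Multiplication by w shifts coefficients. Keeping e as a separate sequence allows closed forms
such as n · a_n for the shifted coefficients. -/
lemma powerSum_shift (h : HasPolyGrowth c) {e : ℕ → ℝ} (h0 : e 0 = 0)
    (h1 : ∀ n, e (n + 1) = c n) {w : ℝ} (hw : |w| < 1) :
    HasSum (fun n => e n * w ^ n) (w * powerSum c w) := by
  rw [← hasSum_nat_add_iff' 1]
  simp only [Finset.range_one, Finset.sum_singleton, h0, zero_mul, sub_zero, h1]
  convert! ((h.summable hw).hasSum.mul_left w) using 2 with n
  ring

end HasPolyGrowth

/-! ### The radial solution -/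

/-- The coefficients of the solution of `(1 - w) (w (1 - w) G')' + l G = 0` with `G 0 = 1`, together
with their partial sums. -/
noncomputable def radialCoeff (l : ℝ) : ℕ → ℝ × ℝ
  | 0 => (1, 1)
  -- Write a_n for the coefficients of G and S_n for their partial sums. Those of G/(1−w) are S_n,
  -- so integrating P' = lG/(1−w) and dividing by w gives flux coefficients l S_n/(n+1). Comparing
  -- coefficients in (1−w)G' = −P/w gives this recursion; carrying S_n avoids a recursion on all
  -- earlier terms.
  | n + 1 =>
    ((n / (n + 1)) * (radialCoeff l n).1 - l * (radialCoeff l n).2 / (n + 1) ^ 2,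
      (radialCoeff l n).2 +
        ((n / (n + 1)) * (radialCoeff l n).1 - l * (radialCoeff l n).2 / (n + 1) ^ 2))

lemma continuous_radialCoeff (n : ℕ) : Continuous fun l => radialCoeff l n := by
  induction n with
  | zero => exact continuous_const
  | succ n ih =>
    simp only [radialCoeff]
    fun_prop

lemma radialCoeff_succ_fst (l : ℝ) (n : ℕ) : (radialCoeff l (n + 1)).1 =
    (n / (n + 1)) * (radialCoeff l n).1 - l * (radialCoeff l n).2 / (n + 1) ^ 2 := rfl

lemma radialCoeff_succ_snd (l : ℝ) (n : ℕ) : (radialCoeff l (n + 1)).2 =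
    (radialCoeff l n).2 + (radialCoeff l (n + 1)).1 := rfl

/-- The recursion multiplies the bound by at most (n+N)/(n+1), exactly the ratio of consecutive
binomials. Uniformity over |l| ≤ N later yields joint continuity in (l, w). -/
lemma abs_radialCoeff_le {l : ℝ} {N : ℕ} (hl : |l| ≤ N) (n : ℕ) :
    |(radialCoeff l n).1| ≤ ((n + N).choose N : ℝ) ∧
      |(radialCoeff l n).2| ≤ (n + 1) * ((n + N).choose N : ℝ) := by
  induction n with
  | zero => simp [radialCoeff]
  | succ n ih =>
    obtain ⟨h1, h2⟩ := ih
    set B : ℝ := ((n + N).choose N : ℝ)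
    set B' : ℝ := ((n + 1 + N).choose N : ℝ)
    have hB : 0 ≤ B := Nat.cast_nonneg _
    have hBB : (n + 1) * B' = (n + 1 + N) * B := by
      have := Nat.choose_mul_succ_eq (n + N) N
      have h3 : (((n + N).choose N * (n + N + 1) : ℕ) : ℝ) =
        ((n + N + 1).choose N * (n + N + 1 - N) : ℕ) := by rw [this]
      rw [show n + N + 1 - N = n + 1 by lia, show n + N + 1 = n + 1 + N by ring] at h3
      push_cast at h3
      linarith
    have hle : B ≤ B' := choose_le_choose_succ n N
    have hn : (0 : ℝ) < n + 1 := by positivity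
    have e1 : |(radialCoeff l (n + 1)).1| ≤ B' := by
      rw [radialCoeff_succ_fst]
      calc |(n / (n + 1)) * (radialCoeff l n).1 - l * (radialCoeff l n).2 / (n + 1) ^ 2|
          ≤ |(n / ((n : ℝ) + 1)) * (radialCoeff l n).1| +
            |l * (radialCoeff l n).2 / ((n : ℝ) + 1) ^ 2| := abs_sub _ _
        _ ≤ (n / (n + 1)) * B + N * ((n + 1) * B) / (n + 1) ^ 2 := by
          rw [abs_mul, abs_div, abs_div, abs_mul, abs_of_nonneg (Nat.cast_nonneg n),
            abs_of_pos hn, abs_of_pos (pow_pos hn 2)]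
          gcongr
        _ = ((n + N) * B) / (n + 1) := by field_simp
        _ ≤ B' := by
          rw [div_le_iff₀ hn]
          linarith
    refine ⟨e1, ?_⟩
    rw [radialCoeff_succ_snd]
    push_cast
    calc |(radialCoeff l n).2 + (radialCoeff l (n + 1)).1|
        ≤ |(radialCoeff l n).2| + |(radialCoeff l (n + 1)).1| := abs_add_le _ _
      _ ≤ (n + 1) * B' + B' := by
        refine add_le_add (h2.trans ?_) e1
        gcongr
      _ = (n + 1 + 1) * B' := by ring

/-- The coefficients of the flux of the radial solution, divided by the variable. -/
noncomputable def fluxCoeff (l : ℝ) (n : ℕ) : ℝ :=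
  l * (radialCoeff l n).2 / (n + 1)

lemma abs_fluxCoeff_le {l : ℝ} {N : ℕ} (hl : |l| ≤ N) (n : ℕ) :
    |fluxCoeff l n| ≤ N * ((n + N).choose N : ℝ) := by
  have h := (abs_radialCoeff_le hl n).2
  have hn : (0 : ℝ) < n + 1 := by positivity
  rw [fluxCoeff, abs_div, abs_mul, abs_of_pos hn, div_le_iff₀ hn]
  calc |l| * |(radialCoeff l n).2| ≤ N * ((n + 1) * ((n + N).choose N : ℝ)) := by gcongr
    _ = _ := by ring

lemma hasPolyGrowth_radialCoeff (l : ℝ) : HasPolyGrowth fun n => (radialCoeff l n).1 := by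
  obtain ⟨N, hN⟩ := exists_nat_ge |l|
  exact ⟨N, 1, fun n => by simpa using (abs_radialCoeff_le hN n).1⟩

lemma hasPolyGrowth_fluxCoeff (l : ℝ) : HasPolyGrowth (fluxCoeff l) := by
  obtain ⟨N, hN⟩ := exists_nat_ge |l|
  exact ⟨N, N, abs_fluxCoeff_le hN⟩

/-- The solution of `(1 - w) (w (1 - w) G')' + l G = 0` that is regular at `0`, with `G 0 = 1`. -/
noncomputable def radialSol (l w : ℝ) : ℝ :=
  powerSum (fun n => (radialCoeff l n).1) w

/-- `-(1 - w) G'` for the radial solution `G`. -/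
noncomputable def radialFlux (l w : ℝ) : ℝ :=
  powerSum (fluxCoeff l) w

lemma radialSol_zero (l : ℝ) : radialSol l 0 = 1 := by
  rw [radialSol, powerSum, tsum_eq_single 0 (fun n hn => by simp [hn])]
  simp [radialCoeff]

lemma contDiffOn_radialSol (l : ℝ) : ContDiffOn ℝ 2 (radialSol l) (Ioo (-1) 1) :=
  (hasPolyGrowth_radialCoeff l).contDiffOn 2

lemma hasDerivAt_radialSol (l : ℝ) {w : ℝ} (hw : |w| < 1) :
    HasDerivAt (radialSol l) (-(radialFlux l w / (1 - w))) w := by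
  have hg := hasPolyGrowth_radialCoeff l
  convert! hg.hasDerivAt hw using 1
  have h1 := (hg.deriv.powerSum_shift (e := fun n => n * (radialCoeff l n).1) (by simp)
    (fun n => by push_cast; rfl) hw)
  have h2 := (hg.deriv.summable hw).hasSum
  have h3 := ((hasPolyGrowth_fluxCoeff l).summable hw).hasSum
  have h4 : HasSum (fun n => fluxCoeff l n * w ^ n)
      (w * powerSum (fun n => (n + 1) * (radialCoeff l (n + 1)).1) w -
        powerSum (fun n => (n + 1) * (radialCoeff l (n + 1)).1) w) := by
    convert! h1.sub h2 using 2 with n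
    rw [radialCoeff_succ_fst, fluxCoeff]
    have hn : (n : ℝ) + 1 ≠ 0 := by positivity
    field_simp
    ring
  have h5 := h3.unique h4
  have hw1 : 1 - w ≠ 0 := by linarith [(abs_lt.1 hw).2]
  rw [← neg_div, div_eq_iff hw1]
  change -(∑' n, fluxCoeff l n * w ^ n) = _
  rw [h5]
  ring

/-- The derivative of P has coefficients l S_n with S_n the partial sums; multiplying by 1 − w takes
differences and leaves l a_n, the coefficients of lG. -/
lemma hasDerivAt_mul_radialFlux (l : ℝ) {w : ℝ} (hw : |w| < 1) :
    HasDerivAt (fun w => w * radialFlux l w) (l * radialSol l w / (1 - w)) w := by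
  have hq := hasPolyGrowth_fluxCoeff l
  convert! (hasDerivAt_id w).mul (hq.hasDerivAt hw) using 1
  have h1 := hq.deriv.powerSum_shift (e := fun n => n * fluxCoeff l n) (by simp)
    (fun n => by push_cast; rfl) hw
  have h2 := (hq.summable hw).hasSum
  have h3 : HasSum (fun n => l * (radialCoeff l n).2 * w ^ n)
      (1 * powerSum (fluxCoeff l) w + w * powerSum (fun n => (n + 1) * fluxCoeff l (n + 1)) w) := by
    convert! (h2.mul_left 1).add h1 using 2 with n
    rw [fluxCoeff]
    have hn : (n : ℝ) + 1 ≠ 0 := by positivity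
    field_simp
    ring
  have hs : HasPolyGrowth fun n => l * (radialCoeff l n).2 := by
    convert! hq.succ_mul using 2 with n
    rw [fluxCoeff]
    field_simp
  have h4 := hs.powerSum_shift
    (e := fun n => l * (radialCoeff l n).2 - l * (radialCoeff l n).1) (by simp [radialCoeff])
    (fun n => by rw [radialCoeff_succ_snd]; ring) hw
  have h5 : powerSum (fun n => l * (radialCoeff l n).2) w =
      1 * powerSum (fluxCoeff l) w + w * powerSum (fun n => (n + 1) * fluxCoeff l (n + 1)) w :=
    h3.tsum_eq
  have h6 : HasSum (fun n => l * ((radialCoeff l n).1 * w ^ n)) (l * radialSol l w) :=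
    ((hasPolyGrowth_radialCoeff l).summable hw).hasSum.mul_left l
  rw [h5] at h4
  have h7 := h6.unique (by
    convert! h3.sub h4 using 2 with n
    ring)
  have hw1 : 1 - w ≠ 0 := by linarith [(abs_lt.1 hw).2]
  rw [div_eq_iff hw1, h7]
  change _ = (1 * powerSum (fluxCoeff l) w +
    w * powerSum (fun n => (n + 1) * fluxCoeff l (n + 1)) w) * _
  ring

lemma continuousOn_powerSum_param {c : ℝ → ℕ → ℝ} (hc : ∀ n, Continuous fun l => c l n)
    (hb : ∀ N : ℕ, ∃ K : ℝ, ∀ l : ℝ, |l| ≤ N → ∀ n, |c l n| ≤ K * ((n + N).choose N : ℝ)) :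
    ContinuousOn (fun x : ℝ × ℝ => powerSum (c x.1) x.2) (univ ×ˢ Ioo (-1) 1) := by
  rintro ⟨l, w⟩ ⟨-, hw⟩
  obtain ⟨N, hN⟩ := exists_nat_gt |l|
  obtain ⟨K, hK⟩ := hb N
  obtain ⟨r, hr, hr1⟩ := exists_between (abs_lt.2 hw)
  have hr0 : 0 ≤ r := (abs_nonneg w).trans hr.le
  have hs := (summable_choose_mul_geometric_of_norm_lt_one (R := ℝ) N (r := r)
    (by rwa [Real.norm_eq_abs, abs_of_nonneg hr0])).mul_left K
  have hcont : ContinuousOn (fun x : ℝ × ℝ => powerSum (c x.1) x.2)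
      (Ioo (-(N : ℝ)) N ×ˢ Ioo (-r) r) := by
    refine continuousOn_tsum (fun n => ?_) hs ?_
    · exact (((hc n).comp continuous_fst).mul (continuous_snd.pow n)).continuousOn
    · rintro n ⟨l', w'⟩ ⟨hl', hw'⟩
      have h1 := hK l' (abs_lt.2 hl').le n
      have h2 : |w'| ≤ r := (abs_lt.2 hw').le
      rw [norm_mul, norm_pow, Real.norm_eq_abs, Real.norm_eq_abs, ← mul_assoc]
      gcongr
      exact (abs_nonneg _).trans h1
  exact (hcont.continuousAt ((isOpen_Ioo.prod isOpen_Ioo).mem_nhds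
    ⟨abs_lt.1 hN, abs_lt.1 hr⟩)).continuousWithinAt

lemma continuousOn_radialSol :
    ContinuousOn (fun x : ℝ × ℝ => radialSol x.1 x.2) (univ ×ˢ Ioo (-1) 1) :=
  continuousOn_powerSum_param (c := fun l n => (radialCoeff l n).1)
    (fun n => (continuous_radialCoeff n).fst)
    fun N => ⟨1, fun l hl n => by simpa using (abs_radialCoeff_le hl n).1⟩

lemma continuousOn_radialFlux :
    ContinuousOn (fun x : ℝ × ℝ => radialFlux x.1 x.2) (univ ×ˢ Ioo (-1) 1) :=
  continuousOn_powerSum_param (c := fluxCoeff)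
    (fun n => (continuous_id.mul (continuous_radialCoeff n).snd).div_const _)
    fun N => ⟨N, fun _ hl n => abs_fluxCoeff_le hl n⟩

/-- The solution and its flux have no common zero. -/
lemma radialSol_sq_add_pos (l : ℝ) {w : ℝ} (h0 : 0 ≤ w) (h1 : w < 1) :
    0 < radialSol l w ^ 2 + (w * radialFlux l w) ^ 2 := by
  set E : ℝ → ℝ := fun w => radialSol l w ^ 2 + (w * radialFlux l w) ^ 2 with hE
  have hE0 : ∀ x, 0 ≤ E x := fun x => by simp only [hE]; positivity
  -- The system is singular at 0: E' contains G·F with F = P/w, which E controls only up to 1/x.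
  -- Hence a Gronwall argument on [a, w] for each a > 0, carrying a zero of E back from w to a. Then
  -- G = 0 on (0, w), against G(0) = 1.
  have hd : ∀ x, |x| < 1 → HasDerivAt E
      (2 * (radialSol l x * radialFlux l x) * (l * x - 1) / (1 - x)) x := by
    intro x hx
    have hx1 : 1 - x ≠ 0 := by linarith [(abs_lt.1 hx).2]
    convert! ((hasDerivAt_radialSol l hx).pow 2).add ((hasDerivAt_mul_radialFlux l hx).pow 2) using 1
    field_simp
    ring
  by_contra hneg
  have hEw : E w = 0 := le_antisymm (not_lt.1 hneg) (hE0 w)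
  have hpos : 0 < w := by
    rcases h0.eq_or_lt with h | h
    · rw [← h] at hEw
      simp [hE, radialSol_zero] at hEw
    · exact h
  have hzero : ∀ a ∈ Ioo 0 w, radialSol l a = 0 := by
    intro a ha
    set K : ℝ := (|l| + 1) / a / (1 - w) with hK
    have hw1 : 0 < 1 - w := by linarith
    have habs : ∀ x ∈ Icc a w, |x| < 1 := fun x hx => by
      rw [abs_of_nonneg (ha.1.le.trans hx.1)]
      exact hx.2.trans_lt h1
    have hmono : MonotoneOn (fun x => E x * Real.exp (K * x)) (Icc a w) := by
      have hd2 : ∀ x ∈ Icc a w, HasDerivAt (fun x => E x * Real.exp (K * x))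
          (2 * (radialSol l x * radialFlux l x) * (l * x - 1) / (1 - x) * Real.exp (K * x) +
            E x * (Real.exp (K * x) * K)) x := fun x hx => by
        have h3 : HasDerivAt (fun x : ℝ => Real.exp (K * x)) (Real.exp (K * x) * K) x := by
          simpa using ((hasDerivAt_id x).const_mul K).exp
        exact (hd x (habs x hx)).mul h3
      apply monotoneOn_of_deriv_nonneg (convex_Icc a w)
      · exact fun x hx => (hd2 x hx).continuousAt.continuousWithinAt
      · exact fun x hx => (hd2 x (interior_subset hx)).differentiableAt.differentiableWithinAt
      · intro x hx
        have hx' := interior_subset hx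
        rw [(hd2 x hx').deriv]
        have hx0 : 0 < x := ha.1.trans_le hx'.1
        have hx1 : 0 < 1 - x := by linarith [hx'.2]
        have k1 : |2 * (radialSol l x * radialFlux l x) * (l * x - 1) / (1 - x)| ≤ K * E x := by
          have s1 : |l * x - 1| ≤ |l| + 1 := by
            refine (abs_sub _ _).trans ?_
            rw [abs_mul, abs_one, abs_of_pos hx0]
            have : |l| * x ≤ |l| * 1 := by gcongr; linarith
            linarith
          have s2 : |2 * (radialSol l x * radialFlux l x)| ≤ E x / a := by
            rw [le_div_iff₀ ha.1]
            have s3 : |2 * (radialSol l x * radialFlux l x)| * x =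
                |2 * (radialSol l x * (x * radialFlux l x))| := by
              rw [← abs_of_pos hx0, ← abs_mul, abs_of_pos hx0]
              congr 1
              ring
            have s4 : |2 * (radialSol l x * (x * radialFlux l x))| ≤ E x := by
              rw [abs_le]
              simp only [hE]
              constructor <;> nlinarith [sq_nonneg (radialSol l x + x * radialFlux l x),
                sq_nonneg (radialSol l x - x * radialFlux l x)]
            have s5 : |2 * (radialSol l x * radialFlux l x)| * a ≤
                |2 * (radialSol l x * radialFlux l x)| * x := by gcongr; exact hx'.1
            linarith
          rw [abs_div, abs_mul, abs_of_pos hx1]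
          calc |2 * (radialSol l x * radialFlux l x)| * |l * x - 1| / (1 - x)
              ≤ (E x / a) * (|l| + 1) / (1 - w) := by
                have := hE0 x
                have h3 := hx'.2
                have h4 := ha.1
                gcongr
            _ = K * E x := by rw [hK]; ring
        have k2 := (abs_le.1 k1).1
        have k3 : 0 ≤ (2 * (radialSol l x * radialFlux l x) * (l * x - 1) / (1 - x) + K * E x) *
          Real.exp (K * x) := mul_nonneg (by linarith) (Real.exp_pos _).le
        linarith
    have h3 := hmono ⟨le_rfl, ha.2.le⟩ ⟨ha.2.le, le_rfl⟩ ha.2.le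
    simp only [hEw, zero_mul] at h3
    have h4 : E a = 0 := le_antisymm (nonpos_of_mul_nonpos_left h3 (Real.exp_pos _)) (hE0 a)
    simp only [hE] at h4
    nlinarith [sq_nonneg (radialSol l a), sq_nonneg (a * radialFlux l a)]
  have hlim : Tendsto (radialSol l) (𝓝[>] 0) (𝓝 1) := by
    rw [← radialSol_zero l]
    exact (hasDerivAt_radialSol l (by simp)).continuousAt.tendsto.mono_left nhdsWithin_le_nhds
  have hlim0 : Tendsto (radialSol l) (𝓝[>] 0) (𝓝 0) := by
    refine tendsto_const_nhds.congr' ?_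
    filter_upwards [Ioo_mem_nhdsGT hpos] with a ha using (hzero a ha).symm
  exact one_ne_zero (tendsto_nhds_unique hlim hlim0)

/-! ### The phase of the radial solution -/

lemma abs_lt_one_of_mem {w x : ℝ} (h1 : w < 1) (hx : x ∈ Icc 0 w) : |x| < 1 := by
  rw [abs_of_nonneg hx.1]
  exact hx.2.trans_lt h1

lemma continuousOn_radialSol_right (l : ℝ) : ContinuousOn (radialSol l) (Ico 0 1) := fun _ hx =>
  (hasDerivAt_radialSol l (abs_lt_one_of_mem hx.2 ⟨hx.1, le_rfl⟩)).continuousAt.continuousWithinAt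

/-- The squared modulus of `κ G + i P`. -/
noncomputable def radialNormSq (κ l w : ℝ) : ℝ :=
  (κ * radialSol l w) ^ 2 + (w * radialFlux l w) ^ 2

lemma radialNormSq_pos {κ : ℝ} (hκ : 0 < κ) (l : ℝ) {w : ℝ} (h0 : 0 ≤ w) (h1 : w < 1) :
    0 < radialNormSq κ l w := by
  have h := radialSol_sq_add_pos l h0 h1
  rw [radialNormSq]
  by_cases hG : radialSol l w = 0
  · rw [hG] at h ⊢
    simpa using h
  · have : 0 < (κ * radialSol l w) ^ 2 := by positivity
    positivity

/-- The angular velocity of the curve `κ G + i P`. -/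
noncomputable def phaseRate (κ l w : ℝ) : ℝ :=
  κ * (l * radialSol l w ^ 2 + w * radialFlux l w ^ 2) / ((1 - w) * radialNormSq κ l w)

/-- The continuous argument of the curve `κ G + i P`. -/
noncomputable def phase (κ l w : ℝ) : ℝ :=
  ∫ x in (0 : ℝ)..w, phaseRate κ l x

lemma continuousOn_phaseRate {κ : ℝ} (hκ : 0 < κ) :
    ContinuousOn (fun x : ℝ × ℝ => phaseRate κ x.1 x.2) (univ ×ˢ Ico 0 1) := by
  have hsub : (univ : Set ℝ) ×ˢ Ico (0 : ℝ) 1 ⊆ univ ×ˢ Ioo (-1) 1 :=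
    prod_mono subset_rfl fun x hx => ⟨by linarith [hx.1], hx.2⟩
  have c1 := continuousOn_radialSol.mono hsub
  have c2 := continuousOn_radialFlux.mono hsub
  have cw : ContinuousOn (fun x : ℝ × ℝ => x.2) ((univ : Set ℝ) ×ˢ Ico (0 : ℝ) 1) := by fun_prop
  have cl : ContinuousOn (fun x : ℝ × ℝ => x.1) ((univ : Set ℝ) ×ˢ Ico (0 : ℝ) 1) := by fun_prop
  refine ContinuousOn.div
    (continuousOn_const.mul ((cl.mul (c1.pow 2)).add (cw.mul (c2.pow 2))))
    ((continuousOn_const.sub cw).mul (((continuousOn_const.mul c1).pow 2).add ((cw.mul c2).pow 2)))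
    ?_
  rintro ⟨l, w⟩ ⟨-, hw⟩
  have h1 := radialNormSq_pos hκ l hw.1 hw.2
  have h2 : 0 < 1 - w := by linarith [hw.2]
  exact (mul_pos h2 h1).ne'

lemma continuousOn_phaseRate_right {κ : ℝ} (hκ : 0 < κ) (l : ℝ) :
    ContinuousOn (phaseRate κ l) (Ico 0 1) :=
  (continuousOn_phaseRate hκ).comp (f := fun x => (l, x)) (by fun_prop)
    fun _ hx => ⟨mem_univ _, hx⟩

lemma intervalIntegrable_phaseRate {κ : ℝ} (hκ : 0 < κ) (l : ℝ) {a w : ℝ} (ha : 0 ≤ a)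
    (haw : a ≤ w) (h1 : w < 1) : IntervalIntegrable (phaseRate κ l) volume a w := by
  refine ((continuousOn_phaseRate_right hκ l).mono ?_).intervalIntegrable
  rw [uIcc_of_le haw]
  exact fun x hx => ⟨ha.trans hx.1, hx.2.trans_lt h1⟩

lemma hasDerivAt_phase {κ : ℝ} (hκ : 0 < κ) (l : ℝ) {w : ℝ} (h0 : 0 < w) (h1 : w < 1) :
    HasDerivAt (phase κ l) (phaseRate κ l w) w := by
  have hc : ContinuousOn (phaseRate κ l) (Ioo 0 1) :=
    (continuousOn_phaseRate_right hκ l).mono Ioo_subset_Ico_self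
  exact intervalIntegral.integral_hasDerivAt_right
    (intervalIntegrable_phaseRate hκ l le_rfl h0.le h1)
    (hc.stronglyMeasurableAtFilter isOpen_Ioo w ⟨h0, h1⟩)
    (hc.continuousAt (isOpen_Ioo.mem_nhds ⟨h0, h1⟩))

lemma continuousOn_phase {κ : ℝ} (hκ : 0 < κ) (l : ℝ) {w : ℝ} (h0 : 0 ≤ w) (h1 : w < 1) :
    ContinuousOn (phase κ l) (Icc 0 w) := by
  have h := (intervalIntegrable_phaseRate hκ l le_rfl h0 h1)
  rw [intervalIntegrable_iff_integrableOn_Icc_of_le h0, ← uIcc_of_le h0] at h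
  have := intervalIntegral.continuousOn_primitive_interval h
  rwa [uIcc_of_le h0] at this

lemma phase_zero (κ l : ℝ) : phase κ l 0 = 0 := by simp [phase]

/-- The phase is defined as an integral of the angular velocity, so it must be shown to be an
argument. The cosine k of the angle between the curve and the unit vector at the phase has
derivative 0 and equals 1 at w = 0. -/
lemma phase_spec {κ : ℝ} (hκ : 0 < κ) (l : ℝ) {w : ℝ} (h0 : 0 ≤ w) (h1 : w < 1) :
    κ * radialSol l w = √(radialNormSq κ l w) * Real.cos (phase κ l w) ∧
      w * radialFlux l w = √(radialNormSq κ l w) * Real.sin (phase κ l w) := by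
  set n : ℝ → ℝ := fun w => √(radialNormSq κ l w) with hn
  have hnpos : ∀ x, 0 ≤ x → x < 1 → 0 < n x := fun x hx0 hx1 =>
    Real.sqrt_pos.2 (radialNormSq_pos hκ l hx0 hx1)
  have hnsq : ∀ x, 0 ≤ x → x < 1 → n x ^ 2 = radialNormSq κ l x := fun x hx0 hx1 =>
    Real.sq_sqrt (radialNormSq_pos hκ l hx0 hx1).le
  set k : ℝ → ℝ := fun x => (κ * radialSol l x * Real.cos (phase κ l x) +
    x * radialFlux l x * Real.sin (phase κ l x)) / n x with hk
  have hN : ∀ x, |x| < 1 → HasDerivAt (radialNormSq κ l)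
      (2 * (κ * radialSol l x) * (κ * -(radialFlux l x / (1 - x))) +
        2 * (x * radialFlux l x) * (l * radialSol l x / (1 - x))) x := by
    intro x hx
    convert! (((hasDerivAt_radialSol l hx).const_mul κ).pow 2).add
      ((hasDerivAt_mul_radialFlux l hx).pow 2) using 1
    simp
  have hn' : ∀ x, 0 ≤ x → x < 1 → HasDerivAt n
      ((2 * (κ * radialSol l x) * (κ * -(radialFlux l x / (1 - x))) +
        2 * (x * radialFlux l x) * (l * radialSol l x / (1 - x))) / (2 * n x)) x := fun x hx0 hx1 =>
    (hN x (abs_lt_one_of_mem hx1 ⟨hx0, le_rfl⟩)).sqrt (radialNormSq_pos hκ l hx0 hx1).ne'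
  have hderiv : ∀ x ∈ Ioo 0 w, HasDerivAt k 0 x := by
    intro x hx
    have hx1 : x < 1 := hx.2.trans h1
    have hxa := abs_lt_one_of_mem hx1 ⟨hx.1.le, le_rfl⟩
    have hφ := hasDerivAt_phase hκ l hx.1 hx1
    have d1 := ((hasDerivAt_radialSol l hxa).const_mul κ).mul hφ.cos
    have d2 := (hasDerivAt_mul_radialFlux l hxa).mul hφ.sin
    have d3 := (d1.add d2).div (hn' x hx.1.le hx1) (hnpos x hx.1.le hx1).ne'
    convert! d3 using 1
    have e1 : (1 - x) ≠ 0 := by linarith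
    have e2 := (hnpos x hx.1.le hx1).ne'
    have e3 : radialNormSq κ l x = n x ^ 2 := (hnsq x hx.1.le hx1).symm
    have e4 : n x ^ 2 = (κ * radialSol l x) ^ 2 + (x * radialFlux l x) ^ 2 := hnsq x hx.1.le hx1
    simp only [phaseRate, e3, Pi.add_apply, Pi.mul_apply]
    clear_value n
    field_simp
    generalize radialSol l x = G at *
    generalize radialFlux l x = Q at *
    generalize Real.cos (phase κ l x) = C
    generalize Real.sin (phase κ l x) = S
    linear_combination (κ * Q * C - G * S * l) * e4
  have hcont : ContinuousOn k (Icc 0 w) := by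
    have hφ := continuousOn_phase hκ l h0 h1
    refine ContinuousOn.div (((continuousOn_const.mul fun x hx => ?_).mul (Real.continuous_cos.comp_continuousOn hφ)).add
      (ContinuousOn.mul (fun x hx => ?_) (Real.continuous_sin.comp_continuousOn hφ))) (fun x hx => ?_) fun x hx => ?_
    · exact (hasDerivAt_radialSol l
        (abs_lt_one_of_mem h1 hx)).continuousAt.continuousWithinAt
    · exact (hasDerivAt_mul_radialFlux l
        (abs_lt_one_of_mem h1 hx)).continuousAt.continuousWithinAt
    · exact (hn' x hx.1 (hx.2.trans_lt h1)).continuousAt.continuousWithinAt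
    · exact (hnpos x hx.1 (hx.2.trans_lt h1)).ne'
  have hk0 : k 0 = 1 := by
    simp [hk, hn, phase_zero, radialNormSq, radialSol_zero, Real.sqrt_sq hκ.le, hκ.ne']
  have hkw : k w = 1 := by
    rcases h0.eq_or_lt with h | h
    · rw [← h, hk0]
    · obtain ⟨c, hc, hc'⟩ := exists_hasDerivAt_eq_slope k (fun _ => 0) h hcont hderiv
      have : w - 0 ≠ 0 := by linarith
      rw [eq_comm, div_eq_zero_iff] at hc'
      rcases hc' with hc' | hc'
      · linarith
      · exact absurd hc' this
  have hp := hnpos w h0 h1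
  have hs := hnsq w h0 h1
  change κ * radialSol l w = n w * _ ∧ w * radialFlux l w = n w * _
  rw [radialNormSq] at hs
  simp only [hk] at hkw
  rw [div_eq_one_iff_eq hp.ne'] at hkw
  have hcs := Real.sin_sq_add_cos_sq (phase κ l w)
  -- Equality in Cauchy–Schwarz: two vectors of length n w with inner product (n w)² coincide.
  have key : (κ * radialSol l w - n w * Real.cos (phase κ l w)) ^ 2 +
      (w * radialFlux l w - n w * Real.sin (phase κ l w)) ^ 2 = 0 := by
    linear_combination (-1 : ℝ) * hs - 2 * n w * hkw + n w ^ 2 * hcs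
  obtain ⟨k1, k2⟩ := (add_eq_zero_iff_of_nonneg (sq_nonneg _) (sq_nonneg _)).1 key
  exact ⟨sub_eq_zero.1 (pow_eq_zero_iff two_ne_zero |>.1 k1),
    sub_eq_zero.1 (pow_eq_zero_iff two_ne_zero |>.1 k2)⟩

lemma radialSol_eq_zero_iff (l : ℝ) {w : ℝ} (h0 : 0 ≤ w) (h1 : w < 1) :
    radialSol l w = 0 ↔ Real.cos (phase 1 l w) = 0 := by
  have h := (phase_spec one_pos l h0 h1).1
  have hp := (Real.sqrt_pos.2 (radialNormSq_pos one_pos l h0 h1)).ne'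
  rw [one_mul] at h
  rw [h, mul_eq_zero]
  simp [hp]

lemma mul_radialFlux_eq_zero_iff (l : ℝ) {w : ℝ} (h0 : 0 ≤ w) (h1 : w < 1) :
    w * radialFlux l w = 0 ↔ Real.sin (phase 1 l w) = 0 := by
  have h := (phase_spec one_pos l h0 h1).2
  have hp := (Real.sqrt_pos.2 (radialNormSq_pos one_pos l h0 h1)).ne'
  rw [h, mul_eq_zero]
  simp [hp]

lemma clamp_mem {w : ℝ} (h1 : w < 1) (x : ℝ) : max 0 (min x w) ∈ Ico (0 : ℝ) 1 :=
  ⟨le_max_left _ _, max_lt one_pos ((min_le_right _ _).trans_lt h1)⟩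

lemma clamp_eq {w x : ℝ} (hx : x ∈ Icc 0 w) : max 0 (min x w) = x := by
  rw [min_eq_left hx.2, max_eq_right hx.1]

/-- Integrals over a compact subinterval of `[0, 1)` depend continuously on the parameter. -/
lemma continuous_integral_of_continuousOn {f : ℝ → ℝ → ℝ}
    (hf : ContinuousOn (fun x : ℝ × ℝ => f x.1 x.2) (univ ×ˢ Ico 0 1)) {w : ℝ} (h0 : 0 ≤ w)
    (h1 : w < 1) : Continuous fun l => ∫ x in (0 : ℝ)..w, f l x := by
  -- Clamping the variable to [0, w] makes the integrand continuous on the whole plane without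
  -- changing the integral.
  have e : ∀ l, ∫ x in (0 : ℝ)..w, f l x = ∫ x in (0 : ℝ)..w, f l (max 0 (min x w)) := by
    intro l
    refine intervalIntegral.integral_congr fun x hx => ?_
    rw [uIcc_of_le h0] at hx
    simp only [clamp_eq hx]
  simp_rw [e]
  refine intervalIntegral.continuous_parametric_intervalIntegral_of_continuous'
    (f := fun l x => f l (max 0 (min x w))) ?_ _ _
  rw [← continuousOn_univ]
  exact hf.comp (f := fun x : ℝ × ℝ => (x.1, max 0 (min x.2 w)))
    (by fun_prop : Continuous fun x : ℝ × ℝ => (x.1, max 0 (min x.2 w))).continuousOn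
    fun x _ => ⟨mem_univ _, clamp_mem h1 x.2⟩

lemma continuous_phase {κ : ℝ} (hκ : 0 < κ) {w : ℝ} (h0 : 0 ≤ w) (h1 : w < 1) :
    Continuous fun l => phase κ l w :=
  continuous_integral_of_continuousOn (continuousOn_phaseRate hκ) h0 h1

/-! ### Monotonicity of the phase in the parameter -/

/-- The Wronskian of two radial solutions. -/
lemma radial_wronskian (l μ : ℝ) {w : ℝ} (h0 : 0 ≤ w) (h1 : w < 1) :
    radialSol l w * (w * radialFlux μ w) - w * radialFlux l w * radialSol μ w =
      (μ - l) * ∫ x in (0 : ℝ)..w, radialSol l x * radialSol μ x / (1 - x) := by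
  have hd : ∀ x ∈ uIcc 0 w, HasDerivAt
      (fun w => radialSol l w * (w * radialFlux μ w) - w * radialFlux l w * radialSol μ w)
      ((μ - l) * (radialSol l x * radialSol μ x / (1 - x))) x := by
    intro x hx
    rw [uIcc_of_le h0] at hx
    have hxa := abs_lt_one_of_mem h1 hx
    have hx1 : 1 - x ≠ 0 := by linarith [(abs_lt.1 hxa).2]
    convert! ((hasDerivAt_radialSol l hxa).mul (hasDerivAt_mul_radialFlux μ hxa)).sub
      ((hasDerivAt_mul_radialFlux l hxa).mul (hasDerivAt_radialSol μ hxa)) using 1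
    field_simp
    ring
  rw [← intervalIntegral.integral_const_mul, intervalIntegral.integral_eq_sub_of_hasDerivAt hd]
  · simp
  · refine ContinuousOn.intervalIntegrable ?_
    rw [uIcc_of_le h0]
    have hsub : Icc 0 w ⊆ Ico 0 1 := fun x hx => ⟨hx.1, hx.2.trans_lt h1⟩
    refine continuousOn_const.mul ((((continuousOn_radialSol_right l).mul
      (continuousOn_radialSol_right μ)).mono hsub).div (by fun_prop) ?_)
    intro x hx
    linarith [(hsub hx).2]

lemma integral_radialSol_sq_pos (l : ℝ) {w : ℝ} (h0 : 0 < w) (h1 : w < 1) :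
    0 < ∫ x in (0 : ℝ)..w, radialSol l x * radialSol l x / (1 - x) := by
  have hsub : Icc 0 w ⊆ Ico 0 1 := fun x hx => ⟨hx.1, hx.2.trans_lt h1⟩
  refine intervalIntegral.integral_pos h0 ?_ ?_ ⟨0, ⟨le_rfl, h0.le⟩, ?_⟩
  · refine (((continuousOn_radialSol_right l).mul
      (continuousOn_radialSol_right l)).mono hsub).div (by fun_prop) fun x hx => ?_
    linarith [(hsub hx).2]
  · intro x hx
    have : 0 < 1 - x := by linarith [hx.2]
    exact div_nonneg (mul_self_nonneg _) this.le
  · simp [radialSol_zero]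

/-- The Wronskian is a positive multiple of the sine of the phase difference, and for μ slightly
above l it is positive, since its integral is near that of G²/(1−x). Continuity keeps the difference
above −π, where a positive sine excludes values ≤ 0. -/
lemma phase_lt_phase_right (l : ℝ) {w : ℝ} (h0 : 0 < w) (h1 : w < 1) :
    ∀ᶠ μ in 𝓝[>] l, phase 1 l w < phase 1 μ w := by
  have hc : Continuous fun μ => ∫ x in (0 : ℝ)..w, radialSol l x * radialSol μ x / (1 - x) := by
    refine continuous_integral_of_continuousOn
      (f := fun μ x => radialSol l x * radialSol μ x / (1 - x)) ?_ h0.le h1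
    have hsub : (univ : Set ℝ) ×ˢ Ico (0 : ℝ) 1 ⊆ univ ×ˢ Ioo (-1) 1 :=
      prod_mono subset_rfl fun x hx => ⟨by linarith [hx.1], hx.2⟩
    refine ContinuousOn.div (ContinuousOn.mul ?_ (continuousOn_radialSol.mono hsub))
      (by fun_prop) fun x hx => ?_
    · exact (continuousOn_radialSol_right l).comp continuousOn_snd fun x hx => hx.2
    · linarith [hx.2.2]
  have e1 := (hc.tendsto l).eventually (lt_mem_nhds (integral_radialSol_sq_pos l h0 h1))
  have e2 : ∀ᶠ μ in 𝓝 l, phase 1 l w - Real.pi < phase 1 μ w :=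
    ((continuous_phase one_pos h0.le h1).tendsto l).eventually
      (lt_mem_nhds (by linarith [Real.pi_pos]))
  filter_upwards [mem_nhdsWithin_of_mem_nhds e1, mem_nhdsWithin_of_mem_nhds e2,
    self_mem_nhdsWithin] with μ h2 h3 h4
  have hW := radial_wronskian l μ h0.le h1
  have hWpos := mul_pos (sub_pos.2 h4) h2
  obtain ⟨a1, a2⟩ := phase_spec one_pos l h0.le h1
  obtain ⟨b1, b2⟩ := phase_spec one_pos μ h0.le h1
  rw [← hW, ← one_mul (radialSol l w), ← one_mul (radialSol μ w), a1, a2, b1, b2] at hWpos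
  have hsin : 0 < √(radialNormSq 1 l w) * √(radialNormSq 1 μ w) *
      Real.sin (phase 1 μ w - phase 1 l w) := by
    rw [Real.sin_sub]
    linarith
  by_contra! hle
  have : Real.sin (phase 1 μ w - phase 1 l w) ≤ 0 :=
    Real.sin_nonpos_of_nonpos_of_neg_pi_le (by linarith) (by linarith)
  have h5 : 0 ≤ √(radialNormSq 1 l w) * √(radialNormSq 1 μ w) := by positivity
  nlinarith

lemma strictMono_of_eventually_nhdsGT {f : ℝ → ℝ} (hc : Continuous f)
    (h : ∀ x, ∀ᶠ y in 𝓝[>] x, f x < f y) : StrictMono f := by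
  have hle : ∀ a b, a ≤ b → f a ≤ f b := by
    intro a b hab
    have hsub : Icc a b ⊆ {x | f a ≤ f x} := by
      refine IsClosed.Icc_subset_of_forall_exists_gt
        ((isClosed_le continuous_const hc).inter isClosed_Icc) (le_refl (f a)) ?_
      rintro x ⟨hx, -⟩ y hy
      obtain ⟨z, hz1, hz2⟩ := ((h x).and (Ioc_mem_nhdsGT hy)).exists
      exact ⟨z, le_trans hx hz1.le, hz2⟩
    exact hsub ⟨hab, le_rfl⟩
  intro a b hab
  obtain ⟨z, hz1, hz2⟩ := ((h a).and (Ioc_mem_nhdsGT hab)).exists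
  exact hz1.trans_le (hle z b hz2.2)

lemma strictMono_phase {w : ℝ} (h0 : 0 < w) (h1 : w < 1) : StrictMono fun l => phase 1 l w :=
  strictMono_of_eventually_nhdsGT (continuous_phase one_pos h0.le h1)
    fun l => phase_lt_phase_right l h0 h1

/-! ### Bounds and growth of the phase -/

lemma phaseRate_nonneg {κ l w : ℝ} (hκ : 0 < κ) (hl : 0 ≤ l) (h0 : 0 ≤ w) (h1 : w < 1) :
    0 ≤ phaseRate κ l w := by
  have h2 := radialNormSq_pos hκ l h0 h1
  have h3 : 0 < 1 - w := by linarith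
  rw [phaseRate]
  positivity

lemma phase_param_zero (κ w : ℝ) : phase κ 0 w = 0 := by
  have h : ∀ x, radialFlux 0 x = 0 := fun x => by simp [radialFlux, powerSum, fluxCoeff]
  simp [phase, phaseRate, h]

lemma phase_nonneg {κ l w : ℝ} (hκ : 0 < κ) (hl : 0 ≤ l) (h0 : 0 ≤ w) (h1 : w < 1) :
    0 ≤ phase κ l w :=
  intervalIntegral.integral_nonneg h0 fun _ hx =>
    phaseRate_nonneg hκ hl hx.1 (hx.2.trans_lt h1)

/-- For l < 0 the product G·P starts at 0 and strictly decreases, so G cannot vanish later, as it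
would at the first arrival at −π/2. This is what makes the list of eigenvalues start at j = 0. -/
lemma neg_pi_div_two_lt_phase (l : ℝ) {w : ℝ} (h0 : 0 ≤ w) (h1 : w < 1) :
    -(Real.pi / 2) < phase 1 l w := by
  have hpi := Real.pi_pos
  rcases le_or_gt 0 l with hl | hl
  · linarith [phase_nonneg one_pos hl h0 h1]
  by_contra! hle
  obtain ⟨x, hx, hxe⟩ : -(Real.pi / 2) ∈ phase 1 l '' Icc 0 w := by
    refine intermediate_value_Icc' h0 (continuousOn_phase one_pos l h0 h1) ⟨hle, ?_⟩
    rw [phase_zero]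
    linarith
  have hx1 : x < 1 := hx.2.trans_lt h1
  have hx0 : 0 < x := by
    rcases hx.1.eq_or_lt with h | h
    · rw [← h, phase_zero] at hxe
      linarith
    · exact h
  have hG : radialSol l x = 0 := by
    rw [radialSol_eq_zero_iff l hx.1 hx1, hxe, Real.cos_neg, Real.cos_pi_div_two]
  have hd : ∀ y ∈ Icc 0 x, HasDerivAt (fun w => radialSol l w * (w * radialFlux l w))
      ((l * radialSol l y ^ 2 - y * radialFlux l y ^ 2) / (1 - y)) y := by
    intro y hy
    have hya := abs_lt_one_of_mem hx1 hy
    have hy1 : 1 - y ≠ 0 := by linarith [(abs_lt.1 hya).2]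
    convert! (hasDerivAt_radialSol l hya).mul (hasDerivAt_mul_radialFlux l hya) using 1
    field_simp
    ring
  have hanti : StrictAntiOn (fun w => radialSol l w * (w * radialFlux l w)) (Icc 0 x) := by
    apply strictAntiOn_of_deriv_neg (convex_Icc 0 x)
    · exact fun y hy => (hd y hy).continuousAt.continuousWithinAt
    · intro y hy
      rw [(hd y (interior_subset hy)).deriv]
      rw [interior_Icc] at hy
      have hy1 : 0 < 1 - y := by linarith [hy.2]
      refine div_neg_of_neg_of_pos ?_ hy1
      have hE := radialSol_sq_add_pos l hy.1.le (by linarith [hy.2])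
      have s1 : 0 ≤ radialSol l y ^ 2 := sq_nonneg _
      have s2 : 0 ≤ radialFlux l y ^ 2 := sq_nonneg _
      have s3 : 0 ≤ y * radialFlux l y ^ 2 := mul_nonneg hy.1.le s2
      rcases s1.eq_or_lt with h | h
      · rw [← h, zero_add, mul_pow] at hE
        have : 0 < radialFlux l y ^ 2 := pos_of_mul_pos_right hE (sq_nonneg _)
        have := mul_pos hy.1 this
        rw [← h]
        linarith
      · nlinarith [mul_pos (neg_pos.2 hl) h]
  have h3 := hanti ⟨le_rfl, hx0.le⟩ ⟨hx0.le, le_rfl⟩ hx0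
  simp [hG] at h3

/-- The vectors (κG, P) and (G, P) have inner product κG² + P² > 0, so they are never orthogonal and
their phase difference, starting at 0, never reaches π/2. -/
lemma phase_le_phase_one_add {κ : ℝ} (hκ : 0 < κ) (l : ℝ) {w : ℝ} (h0 : 0 ≤ w) (h1 : w < 1) :
    phase κ l w ≤ phase 1 l w + Real.pi / 2 := by
  have hpi := Real.pi_pos
  by_contra! hlt
  obtain ⟨x, hx, hxe⟩ : Real.pi / 2 ∈ (fun x => phase κ l x - phase 1 l x) '' Icc 0 w := by
    refine intermediate_value_Icc h0
      ((continuousOn_phase hκ l h0 h1).sub (continuousOn_phase one_pos l h0 h1)) ⟨?_, ?_⟩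
    · simp only [Pi.sub_apply, phase_zero]
      linarith
    · simp only [Pi.sub_apply]
      linarith
  have hx1 : x < 1 := hx.2.trans_lt h1
  have hcos : Real.cos (phase κ l x - phase 1 l x) = 0 := by
    rw [show phase κ l x - phase 1 l x = _ from hxe, Real.cos_pi_div_two]
  obtain ⟨a1, a2⟩ := phase_spec hκ l hx.1 hx1
  obtain ⟨b1, b2⟩ := phase_spec one_pos l hx.1 hx1
  have h2 : (κ * radialSol l x) * (1 * radialSol l x) +
      (x * radialFlux l x) * (x * radialFlux l x) = 0 := by
    rw [a1, b1]
    nth_rewrite 1 [a2]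
    nth_rewrite 1 [b2]
    rw [Real.cos_sub] at hcos
    linear_combination √(radialNormSq κ l x) * √(radialNormSq 1 l x) * hcos
  have hE := radialSol_sq_add_pos l hx.1 hx1
  have s1 : 0 ≤ κ * radialSol l x ^ 2 := by positivity
  have s2 : 0 ≤ (x * radialFlux l x) ^ 2 := sq_nonneg _
  have s3 : κ * radialSol l x ^ 2 = 0 := by nlinarith
  have s4 : (x * radialFlux l x) ^ 2 = 0 := by nlinarith
  have s5 : radialSol l x ^ 2 = 0 := by
    rcases mul_eq_zero.1 s3 with h | h
    · exact absurd h hκ.ne'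
    · exact h
  linarith

/-- The phase grows at least like the square root of the parameter. -/
lemma sqrt_mul_log_le_phase {l a w : ℝ} (hl : 0 < l) (ha : 0 < a) (haw : a ≤ w) (h1 : w < 1) :
    √(l * a) * Real.log ((1 - a) / (1 - w)) - Real.pi / 2 ≤ phase 1 l w := by
  have hκ : 0 < √(l * a) := Real.sqrt_pos.2 (by positivity)
  set κ := √(l * a) with hκd
  have hκ2 : κ ^ 2 = l * a := Real.sq_sqrt (by positivity)
  have hlow : ∀ x ∈ Icc a w, κ * (1 / (1 - x)) ≤ phaseRate κ l x := by
    intro x hx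
    have hx0 : 0 < x := ha.trans_le hx.1
    have hx1 : x < 1 := hx.2.trans_lt h1
    have hp : 0 < 1 - x := by linarith
    have hN := radialNormSq_pos hκ l hx0.le hx1
    rw [phaseRate, mul_one_div, div_le_div_iff₀ hp (mul_pos hp hN)]
    -- This is where κ is tuned: κ² = la ≤ l and x² ≤ x compare the norm with the numerator of the
    -- angular velocity.
    have hle : radialNormSq κ l x ≤ l * radialSol l x ^ 2 + x * radialFlux l x ^ 2 := by
      rw [radialNormSq, mul_pow, mul_pow, hκ2]
      have ha1 : a ≤ 1 := by linarith
      have t1 : l * a * radialSol l x ^ 2 ≤ l * 1 * radialSol l x ^ 2 := by gcongr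
      have t2 : x ^ 2 * radialFlux l x ^ 2 ≤ x * radialFlux l x ^ 2 := by
        gcongr
        nlinarith
      linarith
    have : κ * ((1 - x) * radialNormSq κ l x) ≤
        κ * ((1 - x) * (l * radialSol l x ^ 2 + x * radialFlux l x ^ 2)) := by gcongr
    linarith
  have hint : ∫ x in a..w, κ * (1 / (1 - x)) = κ * Real.log ((1 - a) / (1 - w)) := by
    have hd : ∀ x ∈ uIcc a w, HasDerivAt (fun x => κ * -Real.log (1 - x)) (κ * (1 / (1 - x))) x := by
      intro x hx
      rw [uIcc_of_le haw] at hx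
      have hx1 : 1 - x ≠ 0 := by linarith [hx.2]
      convert! ((((hasDerivAt_id x).const_sub 1).log hx1).neg).const_mul κ using 1
      simp
      ring
    rw [intervalIntegral.integral_eq_sub_of_hasDerivAt hd,
      Real.log_div (by linarith) (by linarith)]
    · ring
    · refine ContinuousOn.intervalIntegrable (continuousOn_const.mul
        (continuousOn_const.div (by fun_prop) fun x hx => ?_))
      rw [uIcc_of_le haw] at hx
      linarith [hx.2]
  have hci : IntervalIntegrable (fun x => κ * (1 / (1 - x))) volume a w := by
    refine ContinuousOn.intervalIntegrable (continuousOn_const.mul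
        (continuousOn_const.div (by fun_prop) fun x hx => ?_))
    rw [uIcc_of_le haw] at hx
    linarith [hx.2]
  have hsplit : phase κ l a + ∫ x in a..w, phaseRate κ l x = phase κ l w :=
    intervalIntegral.integral_add_adjacent_intervals
      (intervalIntegrable_phaseRate hκ l le_rfl ha.le (by linarith))
      (intervalIntegrable_phaseRate hκ l ha.le haw h1)
  have h2 := intervalIntegral.integral_mono_on haw hci
    (intervalIntegrable_phaseRate hκ l ha.le haw h1) hlow
  have h3 := phase_nonneg hκ hl.le ha.le (by linarith : a < 1)
  have h4 := phase_le_phase_one_add hκ l (ha.le.trans haw) h1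
  rw [hint] at h2
  linarith

lemma tendsto_phase_atTop {w : ℝ} (h0 : 0 < w) (h1 : w < 1) :
    Tendsto (fun l => phase 1 l w) atTop atTop := by
  have hlog : 0 < Real.log ((1 - w / 2) / (1 - w)) := by
    apply Real.log_pos
    rw [lt_div_iff₀ (by linarith)]
    linarith
  have h2 : Tendsto (fun l => √(l * (w / 2)) * Real.log ((1 - w / 2) / (1 - w)) - Real.pi / 2)
      atTop atTop := by
    refine tendsto_atTop_add_const_right _ _ (Tendsto.atTop_mul_const hlog ?_)
    exact Real.tendsto_sqrt_atTop.comp (tendsto_id.atTop_mul_const (by positivity))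
  refine tendsto_atTop_mono' _ ?_ h2
  filter_upwards [eventually_gt_atTop 0] with l hl
  exact sqrt_mul_log_le_phase hl (by positivity) (by linarith) h1

/-- The phase vanishes at l = 0 and tends to infinity with l; nonnegative levels are all that is
needed. -/
lemma exists_phase_eq {w : ℝ} (h0 : 0 < w) (h1 : w < 1) {y : ℝ} (hy : 0 ≤ y) :
    ∃ l, phase 1 l w = y := by
  obtain ⟨L, hL, hL0⟩ := ((tendsto_phase_atTop h0 h1).eventually_ge_atTop y |>.and
    (eventually_ge_atTop 0)).exists
  obtain ⟨l, -, hl⟩ := intermediate_value_Icc hL0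
    (continuous_phase one_pos h0.le h1).continuousOn
    (show y ∈ Icc (phase 1 0 w) (phase 1 L w) from ⟨by rwa [phase_param_zero], hL⟩)
  exact ⟨l, hl⟩

/-! ### Rotation invariant eigenfunctions -/

/-- The variable `w = r² / (r² + δ)` of the radial equation. -/
noncomputable def radialVar (δ r : ℝ) : ℝ :=
  r ^ 2 / (r ^ 2 + δ)

lemma radialVar_nonneg {δ : ℝ} (hδ : 0 < δ) (r : ℝ) : 0 ≤ radialVar δ r := by
  rw [radialVar]
  positivity

lemma radialVar_lt_one {δ : ℝ} (hδ : 0 < δ) (r : ℝ) : radialVar δ r < 1 := by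
  rw [radialVar, div_lt_one (by positivity)]
  linarith

lemma abs_radialVar_lt_one {δ : ℝ} (hδ : 0 < δ) (r : ℝ) : |radialVar δ r| < 1 := by
  rw [abs_of_nonneg (radialVar_nonneg hδ r)]
  exact radialVar_lt_one hδ r

/-- This logistic equation is what removes δ from the radial problem when w replaces t. -/
lemma hasDerivAt_radialVar_exp {δ : ℝ} (hδ : 0 < δ) (t : ℝ) :
    HasDerivAt (fun t => radialVar δ (Real.exp t))
      (2 * radialVar δ (Real.exp t) * (1 - radialVar δ (Real.exp t))) t := by
  have hp : Real.exp t ^ 2 + δ ≠ 0 := by positivity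
  have h1 : HasDerivAt (fun t : ℝ => Real.exp t ^ 2) (2 * Real.exp t ^ 2) t := by
    simpa using hasDerivAt_exp_sq_add 0 t
  convert! h1.div (hasDerivAt_exp_sq_add δ t) hp using 1
  rw [radialVar]
  field_simp

lemma hasDerivAt_radialSol_exp {δ : ℝ} (hδ : 0 < δ) (l t : ℝ) :
    HasDerivAt (fun t => radialSol l (radialVar δ (Real.exp t)))
      (-2 * (radialVar δ (Real.exp t) * radialFlux l (radialVar δ (Real.exp t)))) t := by
  convert! (hasDerivAt_radialSol l (abs_radialVar_lt_one hδ (Real.exp t))).comp t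
    (hasDerivAt_radialVar_exp hδ t) using 1
  have h : 1 - radialVar δ (Real.exp t) ≠ 0 := by linarith [radialVar_lt_one hδ (Real.exp t)]
  field_simp

lemma hasDerivAt_radialFlux_exp {δ : ℝ} (hδ : 0 < δ) (l t : ℝ) :
    HasDerivAt
      (fun t => -2 * (radialVar δ (Real.exp t) * radialFlux l (radialVar δ (Real.exp t))))
      (-(4 * l * radialVar δ (Real.exp t)) * radialSol l (radialVar δ (Real.exp t))) t := by
  convert! ((hasDerivAt_mul_radialFlux l (abs_radialVar_lt_one hδ (Real.exp t))).comp t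
    (hasDerivAt_radialVar_exp hδ t)).const_mul (-2) using 1
  have h : 1 - radialVar δ (Real.exp t) ≠ 0 := by linarith [radialVar_lt_one hδ (Real.exp t)]
  field_simp
  ring

/-- The radial solution as a function on the plane. -/
noncomputable def radialFun (δ l : ℝ) (z : ℂ) : ℝ :=
  radialSol l (radialVar δ ‖z‖)

lemma isRotationInvariant_radialFun (δ l : ℝ) : IsRotationInvariant (radialFun δ l) := fun c z => by
  rw [radialFun, radialFun, norm_mul, Circle.norm_coe, one_mul]

lemma radialFun_zero (δ l : ℝ) : radialFun δ l 0 = 1 := by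
  simp [radialFun, radialVar, radialSol_zero]

lemma contDiff_radialFun {δ : ℝ} (hδ : 0 < δ) (l : ℝ) : ContDiff ℝ 2 (radialFun δ l) := by
  have h : ContDiff ℝ 2 (fun z : ℂ => radialVar δ ‖z‖) :=
    contDiff_norm_sq_complex.div (contDiff_norm_sq_complex.add contDiff_const)
      fun z => (norm_sq_add_pos hδ z).ne'
  rw [← contDiffOn_univ] at h ⊢
  exact (contDiffOn_radialSol l).comp h fun z _ => abs_lt.1 (abs_radialVar_lt_one hδ ‖z‖)

lemma radialFun_exp (δ l : ℝ) : (fun t : ℝ => radialFun δ l (Real.exp t : ℝ)) =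
    fun t => radialSol l (radialVar δ (Real.exp t)) := by
  funext t
  rw [radialFun, Complex.norm_real, Real.norm_eq_abs, Real.abs_exp]

/-- Matching 4l/(r²+δ) with γp = γα/(r²+δ) gives l = γα/4, the parameter used from here on. -/
lemma laplacian_radialFun {δ : ℝ} (hδ : 0 < δ) (l : ℝ) (z : ℂ) :
    Laplacian.laplacian (radialFun δ l) z = -(4 * l / (‖z‖ ^ 2 + δ)) * radialFun δ l z := by
  have hC := contDiff_radialFun hδ l
  refine laplacian_eq_of_forall_ne_zero
    (g := fun z => -(4 * l / (‖z‖ ^ 2 + δ)) * radialFun δ l z) isOpen_univ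
    (fun z _ => hC.contDiffAt) (fun z _ => ?_) (fun z _ hz => ?_) z (mem_univ z)
  · have h1 := (norm_sq_add_pos hδ z).ne'
    have h2 : ContinuousAt (radialFun δ l) z := hC.continuous.continuousAt
    fun_prop (disch := assumption)
  · have h := (isRotationInvariant_radialFun δ l).norm_sq_mul_laplacian hz hC.contDiffAt
    have e1 : deriv (fun t => radialSol l (radialVar δ (Real.exp t))) = fun t =>
        -2 * (radialVar δ (Real.exp t) * radialFlux l (radialVar δ (Real.exp t))) :=
      funext fun t => (hasDerivAt_radialSol_exp hδ l t).deriv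
    rw [radialFun_exp, e1, (hasDerivAt_radialFlux_exp hδ l _).deriv,
      Real.exp_log (norm_pos_iff.2 hz)] at h
    have hz2 : ‖z‖ ^ 2 ≠ 0 := pow_ne_zero 2 (norm_ne_zero_iff.2 hz)
    apply mul_left_cancel₀ hz2
    rw [h, radialFun]
    nth_rewrite 1 [radialVar]
    ring

/-- The boundary data of the radial solution. -/
noncomputable def boundaryValue (δ l : ℝ) : BoundaryCondition → ℝ
  | .dirichlet => radialSol l (radialVar δ 1)
  | .neumann => -2 * (radialVar δ 1 * radialFlux l (radialVar δ 1))

lemma fderiv_radialFun_apply_self {δ : ℝ} (hδ : 0 < δ) (l : ℝ) {z : ℂ} (hz : ‖z‖ = 1) :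
    fderiv ℝ (radialFun δ l) z z = boundaryValue δ l .neumann := by
  have hc : HasDerivAt (fun t : ℝ => ((Real.exp t : ℝ) : ℂ) * z)
      (1 * (((Real.exp 0 : ℝ) : ℂ) * z)) 0 := by
    rw [one_mul]
    exact (Real.hasDerivAt_exp 0).ofReal_comp.mul_const z
  have h1 := hasDerivAt_comp_spiral (u := radialFun δ l)
    ((contDiff_radialFun hδ l).differentiable (by norm_num) _) hc
  have e : (fun t : ℝ => radialFun δ l (((Real.exp t : ℝ) : ℂ) * z)) =
      fun t => radialSol l (radialVar δ (Real.exp t)) := by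
    funext t
    rw [radialFun, norm_mul, hz, mul_one, Complex.norm_real, Real.norm_eq_abs, Real.abs_exp]
  rw [e] at h1
  have h2 := h1.unique (hasDerivAt_radialSol_exp hδ l 0)
  simpa [boundaryValue] using h2

/-- The multiple a = 1 produces eigenfunctions; a general a excludes them when the boundary value is
nonzero. -/
lemma holds_iff_of_eqOn {δ : ℝ} (hδ : 0 < δ) (l : ℝ) (b : BoundaryCondition) {u : ℂ → ℝ} {a : ℝ}
    (hu : EqOn u (a • radialFun δ l) (Metric.closedBall 0 1)) :
    b.Holds u ↔ a * boundaryValue δ l b = 0 := by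
  have h1 : (1 : ℂ) ∈ Metric.sphere (0 : ℂ) 1 := by simp
  suffices h : ∀ z ∈ Metric.sphere (0 : ℂ) 1, (match b with
      | .dirichlet => u z
      | .neumann => fderivWithin ℝ u (Metric.closedBall (0 : ℂ) 1) z z) =
        a * boundaryValue δ l b by
    cases b with
    | dirichlet => exact ⟨fun hb => (h 1 h1).symm.trans (hb 1 h1), fun hb z hz => (h z hz).trans hb⟩
    | neumann => exact ⟨fun hb => (h 1 h1).symm.trans (hb 1 h1), fun hb z hz => (h z hz).trans hb⟩
  intro z hz
  have hz' := Metric.sphere_subset_closedBall hz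
  have hzn : ‖z‖ = 1 := by simpa using hz
  cases b with
  | dirichlet =>
    simp only [hu hz', Pi.smul_apply, smul_eq_mul, radialFun, hzn, boundaryValue]
  | neumann =>
    have hd : DifferentiableAt ℝ (radialFun δ l) z :=
      (contDiff_radialFun hδ l).differentiable (by norm_num) z
    simp only
    rw [fderivWithin_congr hu (hu hz'),
      DifferentiableAt.fderivWithin (hd.const_smul a) (uniqueDiffOn_disc z hz'),
      fderiv_const_smul hd, smul_apply, fderiv_radialFun_apply_self hδ l hzn, smul_eq_mul]

/-- The radial solution on the closed disc. -/
noncomputable def radialEigenfunction (δ l : ℝ) : ℂ → ℝ :=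
  (Metric.closedBall (0 : ℂ) 1).indicator (radialFun δ l)

lemma radialEigenfunction_eqOn (δ l : ℝ) :
    EqOn (radialEigenfunction δ l) (radialFun δ l) (Metric.closedBall 0 1) :=
  fun _ hz => indicator_of_mem hz _

lemma radialEigenfunction_mem {δ γ : ℝ} (hδ : 0 < δ) {b : BoundaryCondition}
    (hb : boundaryValue δ (γ * alpha δ / 4) b = 0) :
    radialEigenfunction δ (γ * alpha δ / 4) ∈ invariantEigenspace (density δ) b γ := by
  set l := γ * alpha δ / 4 with hl
  have heq := radialEigenfunction_eqOn δ l
  refine ⟨⟨(contDiff_radialFun hδ l).contDiffOn.congr heq, fun z hz => ?_, ?_, fun z hz =>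
    indicator_of_notMem hz _⟩, fun c z => ?_⟩
  · have hev : radialEigenfunction δ l =ᶠ[𝓝 z] radialFun δ l :=
      heq.eventuallyEq_of_mem
        (mem_of_superset (Metric.isOpen_ball.mem_nhds hz) Metric.ball_subset_closedBall)
    rw [laplaceBeltrami, (InnerProductSpace.laplacian_congr_nhds hev).eq_of_nhds, hev.eq_of_nhds,
      laplacian_radialFun hδ, density, hl]
    have h1 := (alpha_pos hδ).ne'
    have h2 := (norm_sq_add_pos hδ z).ne'
    field_simp
    ring
  · rw [holds_iff_of_eqOn hδ l b (a := 1) (by simpa using heq), hb, mul_zero]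
  · have hiff : (c : ℂ) * z ∈ Metric.closedBall (0 : ℂ) 1 ↔ z ∈ Metric.closedBall (0 : ℂ) 1 := by
      simp only [mem_closedBall_zero_iff, norm_mul, Circle.norm_coe, one_mul]
    by_cases hz : z ∈ Metric.closedBall (0 : ℂ) 1
    · rw [heq hz, heq (hiff.2 hz), isRotationInvariant_radialFun]
    · rw [radialEigenfunction, indicator_of_notMem hz, indicator_of_notMem (hiff.not.2 hz)]

/-- Two solutions of `f'' = -q f` on `(-∞, 0)` whose Wronskian tends to `0` at `-∞` are
proportional, if one of them has no common zero with its derivative. -/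
lemma exists_eq_mul_of_wronskian_tendsto {f f' g g' q : ℝ → ℝ}
    (hf : ∀ t < 0, HasDerivAt f (f' t) t) (hf' : ∀ t < 0, HasDerivAt f' (-q t * f t) t)
    (hg : ∀ t < 0, HasDerivAt g (g' t) t) (hg' : ∀ t < 0, HasDerivAt g' (-q t * g t) t)
    (hE : ∀ t < 0, f t ^ 2 + f' t ^ 2 ≠ 0)
    (hW : Tendsto (fun t => g t * f' t - g' t * f t) atBot (𝓝 0)) :
    ∃ a, ∀ t < 0, g t = a * f t := by
  have const : ∀ {k : ℝ → ℝ}, (∀ t < 0, HasDerivAt k 0 t) → ∀ s < 0, ∀ t < 0, k s = k t := by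
    intro k hk s hs t ht
    exact isOpen_Iio.is_const_of_deriv_eq_zero isPreconnected_Iio
      (fun x hx => (hk x hx).differentiableAt.differentiableWithinAt)
      (fun x hx => (hk x hx).deriv) hs ht
  have hWd : ∀ t < 0, HasDerivAt (fun t => g t * f' t - g' t * f t) 0 t := by
    intro t ht
    convert! ((hg t ht).mul (hf' t ht)).sub ((hg' t ht).mul (hf t ht)) using 1
    ring
  have hW0 : ∀ t < 0, g t * f' t - g' t * f t = 0 := by
    intro t ht
    refine tendsto_nhds_unique (tendsto_const_nhds.congr' ?_) hW
    filter_upwards [eventually_lt_atBot 0] with s hs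
    exact const hWd t ht s hs
  -- The projection coefficient of (g, g') on (f, f'). It makes sense even where f vanishes, and
  -- zero Wronskian makes the vectors parallel.
  set k : ℝ → ℝ := fun t => (g t * f t + g' t * f' t) / (f t ^ 2 + f' t ^ 2) with hk
  have hgk : ∀ t < 0, g t = k t * f t := by
    intro t ht
    have h1 := hW0 t ht
    have h2 := hE t ht
    simp only [hk]
    field_simp
    linear_combination (f' t) * h1
  have hgk' : ∀ t < 0, g' t = k t * f' t := by
    intro t ht
    have h1 := hW0 t ht
    have h2 := hE t ht
    simp only [hk]
    field_simp
    linear_combination (-f t) * h1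
  have hkd : ∀ t < 0, HasDerivAt k 0 t := by
    intro t ht
    have d := (((hg t ht).mul (hf t ht)).add ((hg' t ht).mul (hf' t ht))).div
      (((hf t ht).pow 2).add ((hf' t ht).pow 2)) (hE t ht)
    convert! d using 1
    have h2 := hE t ht
    simp only [Pi.add_apply, Pi.mul_apply, Pi.pow_apply]
    rw [hgk t ht, hgk' t ht, eq_div_iff (pow_ne_zero 2 h2)]
    push_cast
    ring
  exact ⟨k (-1), fun t ht => by rw [hgk t ht, const hkd t ht (-1) (by norm_num)]⟩

/-- Every rotation invariant eigenfunction is a multiple of the radial solution. -/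
lemma exists_eqOn_smul_radialFun {δ γ : ℝ} (hδ : 0 < δ) {b : BoundaryCondition} {u : ℂ → ℝ}
    (hu : u ∈ invariantEigenspace (density δ) b γ) :
    ∃ a : ℝ, EqOn u (a • radialFun δ (γ * alpha δ / 4)) (Metric.closedBall 0 1) := by
  obtain ⟨h, hinv⟩ := hu
  set l := γ * alpha δ / 4 with hl
  have hnorm : ∀ t : ℝ, ‖((Real.exp t : ℝ) : ℂ)‖ = Real.exp t := fun t => by
    rw [Complex.norm_real, Real.norm_eq_abs, Real.abs_exp]
  have hball : ∀ t < 0, ((Real.exp t : ℝ) : ℂ) ∈ Metric.ball (0 : ℂ) 1 := fun t ht => by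
    rw [mem_ball_zero_iff, hnorm]
    simpa using Real.exp_lt_exp.2 ht
  have hc : ∀ t : ℝ, HasDerivAt (fun t : ℝ => ((Real.exp t : ℝ) : ℂ))
      (1 * ((Real.exp t : ℝ) : ℂ)) t := fun t => by
    rw [one_mul]
    exact (Real.hasDerivAt_exp t).ofReal_comp
  set g : ℝ → ℝ := fun t => u (Real.exp t : ℝ) with hgdef
  set g' : ℝ → ℝ := fun t => fderiv ℝ u (Real.exp t : ℝ) (1 * (Real.exp t : ℝ)) with hgdef'
  have hg : ∀ t < 0, HasDerivAt g (g' t) t := fun t ht =>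
    hasDerivAt_comp_spiral ((h.contDiffAt (hball t ht)).differentiableAt (by norm_num)) (hc t)
  have hg' : ∀ t < 0, HasDerivAt g' (-(4 * l * radialVar δ (Real.exp t)) * g t) t := by
    intro t ht
    have h1 := hasDerivAt_fderiv_spiral (c := fun t : ℝ => ((Real.exp t : ℝ) : ℂ))
      (h.contDiffAt (hball t ht)) (hc t)
    have h2 : HasDerivAt g' (deriv g' t) t := h1.differentiableAt.hasDerivAt
    have h3 : deriv g =ᶠ[𝓝 t] g' := by
      filter_upwards [Iio_mem_nhds ht] with s hs using (hg s hs).deriv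
    have hne : ((Real.exp t : ℝ) : ℂ) ≠ 0 := by exact_mod_cast (Real.exp_pos t).ne'
    have h4 := hinv.norm_sq_mul_laplacian hne (h.contDiffAt (hball t ht))
    rw [h.equation_logPolar hδ (hball t ht), hnorm, Real.log_exp] at h4
    have h5 : deriv (deriv g) t = deriv g' t := h3.deriv_eq
    rw [← h5] at h2
    convert! h2 using 1
    refine Eq.trans ?_ h4
    rw [hl, radialVar]
    ring
  obtain ⟨a, ha⟩ := exists_eq_mul_of_wronskian_tendsto
    (q := fun t => 4 * l * radialVar δ (Real.exp t))
    (fun t _ => hasDerivAt_radialSol_exp hδ l t) (fun t _ => hasDerivAt_radialFlux_exp hδ l t)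
    hg hg' (fun t _ => by
      have := radialSol_sq_add_pos l (radialVar_nonneg hδ (Real.exp t))
        (radialVar_lt_one hδ (Real.exp t))
      nlinarith [sq_nonneg (radialVar δ (Real.exp t) * radialFlux l (radialVar δ (Real.exp t)))])
    (by
      -- Regularity at the centre selects the solution: both functions have finite limits as t → −∞
      -- and both t-derivatives tend to 0, so the Wronskian tends to 0.
      have hw : Tendsto (fun t => radialVar δ (Real.exp t)) atBot (𝓝 0) := by
        have hcont : ContinuousAt (radialVar δ) 0 := by
          have : (0 : ℝ) ^ 2 + δ ≠ 0 := by positivity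
          unfold radialVar
          fun_prop (disch := assumption)
        have := hcont.tendsto.comp Real.tendsto_exp_atBot
        rwa [show radialVar δ 0 = 0 by simp [radialVar]] at this
      have hf : Tendsto (fun t => radialSol l (radialVar δ (Real.exp t))) atBot (𝓝 1) := by
        have := (hasDerivAt_radialSol l (w := 0) (by simp)).continuousAt.tendsto.comp hw
        rwa [radialSol_zero] at this
      have hf' : Tendsto (fun t =>
          -2 * (radialVar δ (Real.exp t) * radialFlux l (radialVar δ (Real.exp t))))
          atBot (𝓝 0) := by
        have := ((hasDerivAt_mul_radialFlux l (w := 0) (by simp)).continuousAt.tendsto.comp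
          hw).const_mul (-2)
        simpa using this
      have he : Tendsto (fun t : ℝ => ((Real.exp t : ℝ) : ℂ)) atBot (𝓝 0) :=
        (Complex.continuous_ofReal.tendsto' 0 0 Complex.ofReal_zero).comp Real.tendsto_exp_atBot
      have hgl : Tendsto g atBot (𝓝 (u 0)) := by
        have h0 : ContinuousAt u 0 := (h.contDiffAt (by simp)).continuousAt
        exact h0.tendsto.comp he
      have hgl' : Tendsto g' atBot (𝓝 0) := by
        have h0 : ContinuousAt (fderiv ℝ u) 0 :=
          ((h.contDiffAt (by simp)).fderiv_right (m := 1) (by norm_num)).continuousAt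
        have h1 : ContinuousAt (fun z : ℂ => fderiv ℝ u z (1 * z)) 0 :=
          h0.clm_apply (by fun_prop)
        have := h1.tendsto.comp he
        simp only [mul_zero, map_zero] at this
        exact this
      simpa using (hgl.mul hf').sub (hgl'.mul hf))
  refine ⟨a, ?_⟩
  have hopen : EqOn u (a • radialFun δ l) (Metric.ball (0 : ℂ) 1 ∩ {0}ᶜ) := by
    rintro z ⟨hz, hz0⟩
    have hpos : 0 < ‖z‖ := norm_pos_iff.2 hz0
    have ht : Real.log ‖z‖ < 0 := Real.log_neg hpos (by simpa using hz)
    have h1 := ha _ ht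
    simp only [hgdef] at h1
    rw [Real.exp_log hpos] at h1
    have h2 : u z = u ((‖z‖ : ℝ) : ℂ) := hinv.apply_eq (by simp)
    rw [h2, h1]
    rfl
  refine hopen.of_subset_closure h.contDiffOn.continuousOn
    ((contDiff_radialFun hδ l).continuous.const_smul a).continuousOn
    (inter_subset_left.trans Metric.ball_subset_closedBall) ?_
  have h3 : closure (Metric.ball (0 : ℂ) 1) ⊆ closure (Metric.ball (0 : ℂ) 1 ∩ {0}ᶜ) :=
    closure_minimal ((dense_compl_singleton (0 : ℂ)).open_subset_closure_inter Metric.isOpen_ball)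
      isClosed_closure
  rwa [closure_ball _ one_ne_zero] at h3

/-! ### Multiplicities and the list of invariant eigenvalues -/

lemma rank_invariantEigenspace_of_eq_zero {δ γ : ℝ} (hδ : 0 < δ) {b : BoundaryCondition}
    (hb : boundaryValue δ (γ * alpha δ / 4) b = 0) :
    Module.rank ℝ (invariantEigenspace (density δ) b γ) = 1 := by
  have hne : radialEigenfunction δ (γ * alpha δ / 4) ≠ 0 := fun h => by
    have h1 := congrFun h 0
    rw [radialEigenfunction_eqOn _ _ (by simp), radialFun_zero] at h1
    exact one_ne_zero h1
  have hspan : invariantEigenspace (density δ) b γ =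
      Submodule.span ℝ {radialEigenfunction δ (γ * alpha δ / 4)} := by
    refine le_antisymm (fun u hu => ?_) ?_
    · obtain ⟨a, ha⟩ := exists_eqOn_smul_radialFun hδ hu
      refine Submodule.mem_span_singleton.2 ⟨a, ?_⟩
      funext z
      by_cases hz : z ∈ Metric.closedBall (0 : ℂ) 1
      · rw [ha hz, Pi.smul_apply, Pi.smul_apply, radialEigenfunction_eqOn _ _ hz]
      · rw [hu.1.off_disc z hz, Pi.smul_apply, radialEigenfunction, indicator_of_notMem hz,
          smul_zero]
    · rw [Submodule.span_singleton_le_iff_mem]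
      exact radialEigenfunction_mem hδ hb
  rw [hspan]
  rw [← Module.finrank_eq_rank, finrank_span_singleton hne, Nat.cast_one]

lemma rank_invariantEigenspace_of_ne_zero {δ γ : ℝ} (hδ : 0 < δ) {b : BoundaryCondition}
    (hb : boundaryValue δ (γ * alpha δ / 4) b ≠ 0) :
    Module.rank ℝ (invariantEigenspace (density δ) b γ) = 0 := by
  have hbot : invariantEigenspace (density δ) b γ = ⊥ := by
    rw [Submodule.eq_bot_iff]
    intro u hu
    obtain ⟨a, ha⟩ := exists_eqOn_smul_radialFun hδ hu
    have h1 := (holds_iff_of_eqOn hδ _ b ha).1 hu.1.boundary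
    have h2 : a = 0 := (mul_eq_zero.1 h1).resolve_right hb
    funext z
    by_cases hz : z ∈ Metric.closedBall (0 : ℂ) 1
    · rw [ha hz, h2, zero_smul]
    · exact hu.1.off_disc z hz
  rw [hbot, rank_bot]

/-- The values of the phase at the eigenvalues. -/
noncomputable def phaseLevel (b : BoundaryCondition) (j : ℕ) : ℝ :=
  (match b with
    | .dirichlet => Real.pi / 2
    | .neumann => 0) + j * Real.pi

lemma phaseLevel_nonneg (b : BoundaryCondition) (j : ℕ) : 0 ≤ phaseLevel b j := by
  have := Real.pi_pos
  cases b <;> simp only [phaseLevel] <;> positivity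

lemma phaseLevel_strictMono (b : BoundaryCondition) : StrictMono (phaseLevel b) := fun i j hij => by
  have : (i : ℝ) < j := by exact_mod_cast hij
  have h2 := Real.pi_pos
  simp only [phaseLevel]
  gcongr

lemma phaseLevel_lt {b : BoundaryCondition} {j m : ℕ} (hj : j < m) :
    phaseLevel b j < m * Real.pi := by
  have h1 : (j : ℝ) + 1 ≤ m := by exact_mod_cast hj
  have h2 := Real.pi_pos
  have h3 : ((j : ℝ) + 1) * Real.pi ≤ m * Real.pi := by gcongr
  cases b <;> simp only [phaseLevel] <;> linarith

lemma boundaryValue_eq_zero_iff {δ : ℝ} (hδ : 0 < δ) (l : ℝ) (b : BoundaryCondition) :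
    boundaryValue δ l b = 0 ↔ ∃ j : ℕ, phase 1 l (radialVar δ 1) = phaseLevel b j := by
  have h0 := radialVar_nonneg hδ 1
  have h1 := radialVar_lt_one hδ 1
  have hlow := neg_pi_div_two_lt_phase l h0 h1
  have hpi := Real.pi_pos
  -- The lower bound −π/2 for the phase forces k > −1 in both cases: from (2k+1)π/2 > −π/2 and from
  -- kπ > −π/2.
  have hnat : ∀ k : ℤ, (-1 : ℝ) < k → ∃ j : ℕ, (j : ℝ) = k := by
    intro k hk
    have : (-1 : ℤ) < k := by exact_mod_cast hk
    obtain ⟨j, hj⟩ := Int.eq_ofNat_of_zero_le (by lia : 0 ≤ k)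
    exact ⟨j, by rw [hj]; simp⟩
  cases b with
  | dirichlet =>
    rw [boundaryValue, radialSol_eq_zero_iff l h0 h1, Real.cos_eq_zero_iff]
    constructor
    · rintro ⟨k, hk⟩
      obtain ⟨j, hj⟩ := hnat k (by
        rw [hk] at hlow
        nlinarith)
      exact ⟨j, by rw [hk, phaseLevel, hj]; ring⟩
    · rintro ⟨j, hj⟩
      exact ⟨j, by rw [hj, phaseLevel]; push_cast; ring⟩
  | neumann =>
    have : boundaryValue δ l .neumann = 0 ↔
        radialVar δ 1 * radialFlux l (radialVar δ 1) = 0 := by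
      rw [boundaryValue, mul_eq_zero]
      simp
    rw [this, mul_radialFlux_eq_zero_iff l h0 h1, Real.sin_eq_zero_iff]
    constructor
    · rintro ⟨k, hk⟩
      obtain ⟨j, hj⟩ := hnat k (by
        rw [← hk] at hlow
        nlinarith)
      exact ⟨j, by rw [← hk, phaseLevel, hj]; ring⟩
    · rintro ⟨j, hj⟩
      exact ⟨j, by rw [hj, phaseLevel]; push_cast; ring⟩

lemma radialVar_one {δ : ℝ} : radialVar δ 1 = 1 / (1 + δ) := by
  simp [radialVar]

/-- The list of the rotation invariant eigenvalues in terms of the phase. -/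
lemma exists_isInvariantEigenvalueList {δ : ℝ} (hδ : 0 < δ) (b : BoundaryCondition) :
    ∃ ev : ℕ → ℝ, IsInvariantEigenvalueList (density δ) b ev ∧
      ∀ j, phase 1 (ev j * alpha δ / 4) (radialVar δ 1) = phaseLevel b j := by
  have h0 : 0 < radialVar δ 1 := by
    rw [radialVar_one]
    positivity
  have h1 := radialVar_lt_one hδ 1
  have hα := alpha_pos hδ
  have hmono := strictMono_phase h0 h1
  choose L hL using fun j => exists_phase_eq h0 h1 (phaseLevel_nonneg b j)
  have hev : ∀ j, 4 / alpha δ * L j * alpha δ / 4 = L j := fun j => by field_simp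
  have hLmono : StrictMono L := fun i j hij => by
    have h2 := phaseLevel_strictMono b hij
    rw [← hL i, ← hL j] at h2
    exact hmono.lt_iff_lt.1 h2
  have hevmono : StrictMono fun j => 4 / alpha δ * L j := fun i j hij => by
    have h2 := hLmono hij
    simp only
    gcongr
  refine ⟨fun j => 4 / alpha δ * L j, ⟨hevmono.monotone, fun γ => ?_⟩, fun j => by
    simp only [hev, hL]⟩
  by_cases hγ : boundaryValue δ (γ * alpha δ / 4) b = 0
  · rw [rank_invariantEigenspace_of_eq_zero hδ hγ, eq_comm, Cardinal.eq_one_iff_unique]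
    obtain ⟨j, hj⟩ := (boundaryValue_eq_zero_iff hδ _ b).1 hγ
    refine ⟨⟨fun x y => Subtype.ext (hevmono.injective (x.2.trans y.2.symm))⟩, ⟨⟨j, ?_⟩⟩⟩
    rw [← hL j] at hj
    have h2 := hmono.injective hj
    simp only
    rw [← h2]
    field_simp
  · rw [rank_invariantEigenspace_of_ne_zero hδ hγ, eq_comm, Cardinal.mk_eq_zero_iff]
    refine ⟨fun ⟨j, hj⟩ => hγ ((boundaryValue_eq_zero_iff hδ _ b).2 ⟨j, ?_⟩)⟩
    rw [← hj, hev, hL]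

lemma exists_forall_lt_phase (m : ℕ) {ε : ℝ} (hε : 0 < ε) :
    ∃ d, 0 < d ∧ d ≤ ε ∧ ∀ δ ∈ Ioo 0 d,
      m * Real.pi < phase 1 (ε * alpha δ / 4) (radialVar δ 1) := by
  -- Set y = 1/α. The phase bound with a = 1/2 and l = εα/4 is √(εα/8)(y − log 2) − π/2. The 2
  -- ensures y − log 2 ≥ y/2; then the main term squared is at least εy/32, whence the 32. Using m +
  -- 1 rather than m absorbs the −π/2.
  set Y : ℝ := max 2 (32 * ((m + 1) * Real.pi) ^ 2 / ε) with hY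
  have hev : ∀ᶠ δ in 𝓝[>] (0 : ℝ), δ < 1 ∧ Y ≤ 1 / alpha δ :=
    (eventually_nhdsWithin_of_eventually_nhds (eventually_lt_nhds one_pos)).and
      (tendsto_one_div_alpha.eventually_ge_atTop Y)
  obtain ⟨d, hd, hsub⟩ := mem_nhdsGT_iff_exists_Ioo_subset.1 hev
  -- The bound by ε is not needed for the phase; it makes the intervals shrink so that the
  -- non-invariant spectrum grows as ε → 0.
  refine ⟨min d ε, lt_min hd hε, min_le_right _ _, fun δ hδ => ?_⟩
  obtain ⟨hδ1, hδY⟩ := hsub ⟨hδ.1, hδ.2.trans_le (min_le_left _ _)⟩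
  have hδ0 := hδ.1
  have hα := alpha_pos hδ0
  set y := 1 / alpha δ with hy
  have hαy : alpha δ = 1 / y := by rw [hy, one_div_one_div]
  have hy2 : 2 ≤ y := (le_max_left _ _).trans hδY
  have hyε : 32 * ((m + 1) * Real.pi) ^ 2 ≤ ε * y := by
    have := (le_max_right _ _).trans hδY
    rw [div_le_iff₀ hε] at this
    linarith
  have hw1 : radialVar δ 1 < 1 := radialVar_lt_one hδ0 1
  have hw2 : 1 / 2 ≤ radialVar δ 1 := by
    rw [radialVar_one, div_le_div_iff₀ (by norm_num) (by positivity)]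
    linarith
  have key := sqrt_mul_log_le_phase (l := ε * alpha δ / 4) (by positivity)
    (by norm_num : (0 : ℝ) < 1 / 2) hw2 hw1
  have hlog : Real.log ((1 - 1 / 2) / (1 - radialVar δ 1)) = y - Real.log 2 := by
    have e : (1 - 1 / 2 : ℝ) / (1 - radialVar δ 1) = (1 + δ) / δ / 2 := by
      have h1 : 1 - 1 / (1 + δ) = δ / (1 + δ) := by
        field_simp
        ring
      rw [radialVar_one, h1]
      field_simp
      norm_num
    rw [e, Real.log_div (by positivity) two_ne_zero, ← one_div_alpha]
  have hlog2 : Real.log 2 ≤ 1 := by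
    have := Real.log_two_lt_d9
    linarith
  have hhalf : y / 2 ≤ y - Real.log 2 := by linarith
  have hsq : ((m : ℝ) + 1) * Real.pi ≤ √(ε * alpha δ / 4 * (1 / 2)) * (y / 2) := by
    have hpi := Real.pi_pos
    rw [← Real.sqrt_sq (by positivity : 0 ≤ y / 2), ← Real.sqrt_mul (by positivity)]
    apply Real.le_sqrt_of_sq_le
    have e : ε * alpha δ / 4 * (1 / 2) * (y / 2) ^ 2 = ε * y / 32 := by
      rw [hαy]
      field_simp
      norm_num
    rw [e]
    linarith
  have hpi := Real.pi_pos
  have h3 : √(ε * alpha δ / 4 * (1 / 2)) * (y / 2) ≤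
      √(ε * alpha δ / 4 * (1 / 2)) * (y - Real.log 2) := by gcongr
  rw [hlog] at key
  linarith

end DiscSpectrum

theorem theorem1 :
    (∀ δ : ℝ, 0 < δ →
      ContDiff ℝ ∞ (density δ) ∧
      (∀ z : ℂ, 0 < density δ z) ∧
      IsRotationInvariant (density δ) ∧
      (∀ z ∈ Metric.closedBall (0 : ℂ) 1, 0 < gaussCurvature (density δ) z) ∧
      area (density δ) = Real.pi) ∧
    (∀ m : ℕ, 0 < m → ∃ δ₀ : ℝ → ℝ,
      (∀ ε : ℝ, 0 < ε → 0 < δ₀ ε ∧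
        ∀ δ ∈ Ioo 0 (δ₀ ε), ∀ b : BoundaryCondition,
          ∃ ev : ℕ → ℝ, IsInvariantEigenvalueList (density δ) b ev ∧ ∀ j < m, ev j < ε) ∧
      (∀ C : ℝ, ∃ ε₀ : ℝ, 0 < ε₀ ∧ ∀ ε ∈ Ioo 0 ε₀, ∀ δ ∈ Ioo 0 (δ₀ ε),
        ∀ b : BoundaryCondition, ∀ γ ∈ nonInvariantSpectrum (density δ) b, C < γ)) ∧
    (∀ δ : ℝ, 0 < δ → ∀ b : BoundaryCondition,
      ∀ γ ∈ nonInvariantSpectrum (density δ) b, 1 / alpha δ ≤ γ) ∧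
    (∃ c : ℝ, 0 < c ∧ ∀ δ : ℝ, 0 < δ → ∀ b : BoundaryCondition,
      ∀ γ ∈ nonInvariantSpectrum (density δ) b, c ≤ γ) ∧
    Tendsto (fun δ : ℝ => 1 / alpha δ) (𝓝[>] 0) atTop := by
  refine ⟨fun δ hδ => ⟨contDiff_density hδ, density_pos hδ, isRotationInvariant_density δ,
    fun z _ => gaussCurvature_density_pos hδ z, area_density hδ⟩, fun m _ => ?_,
    fun δ hδ b γ hγ => one_div_alpha_le_of_mem_nonInvariantSpectrum hδ hγ,
    ⟨1, one_pos, fun δ hδ b γ hγ => one_le_of_mem_nonInvariantSpectrum hδ hγ⟩,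
    tendsto_one_div_alpha⟩
  choose! δ₀ hpos hle hphase using fun (ε : ℝ) (hε : 0 < ε) => exists_forall_lt_phase m hε
  refine ⟨δ₀, fun ε hε => ⟨hpos ε hε, fun δ hδ b => ?_⟩, fun C => ?_⟩
  · obtain ⟨ev, hlist, hev⟩ := exists_isInvariantEigenvalueList hδ.1 b
    refine ⟨ev, hlist, fun j hj => ?_⟩
    have h0 : 0 < radialVar δ 1 := by
      have := hδ.1
      rw [radialVar_one]
      positivity
    have h1 := (phaseLevel_lt (b := b) hj).trans (hphase ε hε δ hδ)
    rw [← hev j] at h1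
    have h2 := (strictMono_phase h0 (radialVar_lt_one hδ.1 1)).lt_iff_lt.1 h1
    have h3 := alpha_pos hδ.1
    exact lt_of_mul_lt_mul_right (by linarith) h3.le
  -- Since δ < δ₀(ε) ≤ ε < e^{−C}, the bound 1/α = log(1 + 1/δ) exceeds C.
  · refine ⟨Real.exp (-C), Real.exp_pos _, fun ε hε δ hδ b γ hγ => ?_⟩
    refine lt_of_lt_of_le ?_ (one_div_alpha_le_of_mem_nonInvariantSpectrum hδ.1 hγ)
    have h1 : δ < Real.exp (-C) := (hδ.2.trans_le (hle ε hε.1)).trans hε.2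
    have h2 := hδ.1
    rw [one_div_alpha, Real.lt_log_iff_exp_lt (by positivity), lt_div_iff₀ h2]
    calc Real.exp C * δ < Real.exp C * Real.exp (-C) := by gcongr
      _ = 1 := by rw [← Real.exp_add]; simp
      _ < 1 + δ := by linarith
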